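/- Let $p$ be a prime, $s\ge 1$, let $0<n_1<\dots<n_s$ be integers and $r_1,\dots,r_s$ nonzero cardinals (possibly infinite). Let $G\cong\bigoplus_{i=1}^s G_i$ be an abelian group with $G_i=(\mathbb Z/p^{n_i})^{(r_i)}$, a direct sum of $r_i$ copies of $\mathbb Z/p^{n_i}$; fix such a decomposition, with basis $x_{i,l}$ ($1\le i\le s$, $l$ in an index set $X_i$ of cardinality $r_i$). Let $\mathcal E=\operatorname{End}(G)$, let $\mathcal J$ be its Jacobson radical, $\Delta(G)=1+\mathcal J\le\operatorname{Aut}(G)$, and let $Z$ be the set of elements of $\Delta(G)$ that lie in the center of $\mathcal E$. Let $(\mathcal J_t)_{t\ge 0}$ be the upper annihilating series of $\mathcal J$: $\mathcal J_0=0$ and, for $t\ge 1$, $$\mathcal J_t=\{a\in\mathcal J : a\mathcal J\subseteq \mathcal J_{t-1},\ \mathcal J a\subseteq\mathcal J_{t-1}\}.$$ Let $(\mathcal Z_t)_{t\ge 0}$ be the upper central series of the group $\Delta(G)$ ($\mathcal Z_0=1$). Let $\sigma(G)=\min_{2\le j\le s}(n_j-n_{j-1})$, with $\sigma(G)=\infty$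 if $s=1$. Define integers $\alpha(i,j,t)\ge 0$ for $1\le i,j\le s$, $t\ge 1$, by $\alpha(s,s,1)=1$, $\alpha(i,j,1)=0$ for $(i,j)\ne(s,s)$, and, for $t\ge 2$, $$\alpha(i,j,t)=\min\{\,n_j-n_{j-1}+\alpha(i,j-1,t-1),\ n_i-n_{i-1}+\alpha(i-1,j,t-1),\ \alpha(i,j,t-1)+1,\ \alpha(i+1,j,t-1),\ \alpha(i,j+1,t-1)\,\},$$ where the terms with an index outside $\{1,\dots,s\}$ are omitted. For $C\in\mathcal E$ let $c_{ij}^{(l,k)}\in\mathbb Z/p^{n_j}$ ($l\in X_i$, $k\in X_j$) be the coefficient of $C(x_{i,l})$ at $x_{j,k}$. Suppose that at least one of the following holds: (1) $p\ge 3$; (2) $\sigma(G)\ge 2$; (3) $r_s>1$ and $s\ge 2$. Then for all $t\ge 1$ $$\mathcal Z_t=(1+\mathcal J_t)\,Z ,$$ and, for every choice of an index $r\in X_s$, $\mathcal Z_t$ is the set of all $1+C\in\Delta(G)$ such that, for all indices, $$\begin{array}{ll} c_{ij}^{(l,k)}\equiv 0 \pmod{p^{n_j-\alpha(i,j,t)}}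 & (i\ne j),\\ c_{ii}^{(l,l)}\equiv c_{ss}^{(r,r)} \pmod{p^{n_i-\alpha(i,i,t)}} & (1\le i\le s),\\ c_{ii}^{(l,k)}\equiv 0 \pmod{p^{n_i-\alpha(i,i,t)}} & (l\ne k),\end{array}$$ where a congruence modulo $p^e$ with $e\le 0$ is no condition. -/

import Mathlib

open scoped Pointwise DirectSum Cardinal

universe u v

/-- The direct sum `⨁ i, G i` of homocyclic groups, where `G i` is a direct sum of copies of
`ZMod (p ^ n i)` indexed by `κ i`; the `p`-rank of `G i` is the cardinal of `κ i`. The index `i`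
runs through `Fin (m + 1)`, so there are `s = m + 1` summands and the last one is
`Fin.last m`. -/
abbrev HomocyclicSum {m : ℕ} (p : ℕ) (n : Fin (m + 1) → ℕ) (κ : Fin (m + 1) → Type u) : Type u :=
  ⨁ i : Fin (m + 1), (κ i →₀ ZMod (p ^ n i))

/-- The minimum gap `σ = min (n (j + 1) - n j)` of an increasing sequence; it is `⊤`, the minimum
of the empty set, for a sequence with one term. -/
noncomputable def minGap {m : ℕ} (n : Fin (m + 1) → ℕ) : ℕ∞ :=
  ⨅ j : Fin m, ((n j.succ - n j.castSucc : ℕ) : ℕ∞)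

section Rings

variable {R : Type v} [Ring R]

/-- The upper annihilating series of a two-sided ideal `I`: the zero ideal at `0`, and at `t + 1`
the ideal of all `a ∈ I` such that `a I` and `I a` lie in the ideal at `t`. -/
def upperAnnSeries (I : Ideal R) [I.IsTwoSided] : ℕ → Ideal R
  | 0 => ⊥
  | t + 1 =>
    { carrier := {a | a ∈ I ∧ ∀ b ∈ I, a * b ∈ upperAnnSeries I t ∧ b * a ∈ upperAnnSeries I t}
      zero_mem' := by simp
      add_mem' := by
        rintro a a' ⟨ha, h⟩ ⟨ha', h'⟩
        refine ⟨I.add_mem ha ha', fun b hb => ⟨?_, ?_⟩⟩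
        · rw [add_mul]
          exact Ideal.add_mem _ (h b hb).1 (h' b hb).1
        · rw [mul_add]
          exact Ideal.add_mem _ (h b hb).2 (h' b hb).2
      smul_mem' := by
        rintro r a ⟨ha, h⟩
        refine ⟨I.mul_mem_left r ha, fun b hb => ⟨?_, ?_⟩⟩
        · rw [smul_eq_mul, mul_assoc]
          exact Ideal.mul_mem_left _ r (h b hb).1
        · rw [smul_eq_mul, ← mul_assoc]
          exact (h (b * r) (I.mul_mem_right r hb)).2 }

/-- The set `1 + I` of units of `R`, for an ideal `I`. -/
def oneAdd (I : Ideal R) : Set Rˣ := {x | (x : R) - 1 ∈ I}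

/-- The group of units in `1 + I`, for a two-sided ideal `I`. -/
def oneAddSubgroup (I : Ideal R) [I.IsTwoSided] : Subgroup Rˣ where
  carrier := oneAdd I
  one_mem' := by simp [oneAdd]
  mul_mem' := by
    intro x y hx hy
    have h : ((x * y : Rˣ) : R) - 1 = ((x : R) - 1) * y + ((y : R) - 1) := by
      push_cast
      noncomm_ring
    simp only [oneAdd, Set.mem_ofPred_eq] at hx hy ⊢
    rw [h]
    exact I.add_mem (I.mul_mem_right _ hx) hy
  inv_mem' := by
    intro x hx
    have h : ((x⁻¹ : Rˣ) : R) - 1 = -((x⁻¹ : Rˣ) : R) * ((x : R) - 1) := by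
      rw [mul_sub, neg_mul, Units.inv_mul]
      noncomm_ring
    simp only [oneAdd, Set.mem_ofPred_eq] at hx ⊢
    rw [h]
    exact I.mul_mem_left _ hx

end Rings

section Groups

variable (G : Type v) [AddCommGroup G]

/-- `Δ(G) = 1 + 𝒥`, where `𝒥` is the Jacobson radical of the endomorphism ring of `G`, as a
subgroup of the automorphism group of `G` (the unit group of the endomorphism ring). -/
noncomputable def radicalGroup : Subgroup (AddMonoid.End G)ˣ :=
  oneAddSubgroup (Ring.jacobson (AddMonoid.End G))

/-- `Z = Δ(G) ∩ 𝒵`, where `𝒵` is the center of the endomorphism ring of `G`. -/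
def centralPart : Set (AddMonoid.End G)ˣ :=
  {x | x ∈ radicalGroup G ∧ (x : AddMonoid.End G) ∈ Subring.center (AddMonoid.End G)}

/-- The `t`-th term of the upper central series of `Δ(G)`, as a set of automorphisms of `G`. -/
def hypercenter (t : ℕ) : Set (AddMonoid.End G)ˣ :=
  (radicalGroup G).subtype '' (Subgroup.upperCentralSeries (radicalGroup G) t)

end Groups

/-- The entry `c_{ij}^{(l,k)}` of the matrix of an endomorphism `f` with respect to a decomposition
`e` of `G` into cyclic groups: the coefficient, in `ZMod (p ^ n j)`, at the `k`-th basis element of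
the `j`-th summand of the image of the `l`-th basis element of the `i`-th summand. -/
noncomputable def matrixEntry {m p : ℕ} {n : Fin (m + 1) → ℕ} {κ : Fin (m + 1) → Type u}
    {G : Type v} [AddCommGroup G] (e : G ≃+ HomocyclicSum p n κ) (f : AddMonoid.End G)
    (i j : Fin (m + 1)) (l : κ i) (k : κ j) : ZMod (p ^ n j) :=
  e (f (e.symm (DirectSum.of (fun i => κ i →₀ ZMod (p ^ n i)) i (Finsupp.single l 1)))) j k

/-- The upper function `α (i, j, t)` of the sequence `n`. For `t = 1` it is `1` at the last pair
of indices and `0` elsewhere. Then `α (i, j, t + 1)` is the minimum of `α (i, j, t) + 1`,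
`n j - n (j - 1) + α (i, j - 1, t)`, `n i - n (i - 1) + α (i - 1, j, t)`, `α (i + 1, j, t)` and
`α (i, j + 1, t)`, where a term is omitted if one of its indices is out of range (here it is
replaced by the first term). -/
def upperFun {m : ℕ} (n : Fin (m + 1) → ℕ) : ℕ → Fin (m + 1) → Fin (m + 1) → ℕ
  | 0, _, _ => 0
  | 1, i, j => if i = Fin.last m ∧ j = Fin.last m then 1 else 0
  | t + 2, i, j =>
    let a := upperFun n (t + 1)
    let c₀ := a i j + 1
    let c₁ := if 0 < (j : ℕ) then
      let j' : Fin (m + 1) := ⟨j - 1, by omega⟩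
      n j - n j' + a i j' else c₀
    let c₂ := if 0 < (i : ℕ) then
      let i' : Fin (m + 1) := ⟨i - 1, by omega⟩
      n i - n i' + a i' j else c₀
    let c₃ := if h : (i : ℕ) < m then a ⟨i + 1, by omega⟩ j else c₀
    let c₄ := if h : (j : ℕ) < m then a i ⟨j + 1, by omega⟩ else c₀
    min c₀ (min (min c₁ c₂) (min c₃ c₄))

/-- The set of all `1 + C` in `Δ(G)` such that the entries of the matrix `C` satisfy
`c_{ij}^{(l,k)} ≡ 0` modulo `p ^ (n j - α (i, j, t))` for `i ≠ j`, and modulo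
`p ^ (n i - α (i, i, t))` also `c_{ii}^{(l,l)} ≡ c_{ss}^{(r,r)}` and `c_{ii}^{(l,k)} ≡ 0` for
`l ≠ k`. Here `s = Fin.last m`, and `r` is a basis element of the last homocyclic summand.
The congruences are between representatives of the entries; each modulus divides the orders of the
cyclic groups that the entries lie in, and it is `1` if the exponent is not positive. -/
def congruenceSet {m p : ℕ} {n : Fin (m + 1) → ℕ} {κ : Fin (m + 1) → Type u}
    {G : Type v} [AddCommGroup G] (e : G ≃+ HomocyclicSum p n κ) (r : κ (Fin.last m)) (t : ℕ) :
    Set (AddMonoid.End G)ˣ :=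
  {x | x ∈ radicalGroup G ∧
    let c := matrixEntry e ((x : AddMonoid.End G) - 1)
    (∀ i j, i ≠ j → ∀ l k, (c i j l k).val ≡ 0 [MOD p ^ (n j - upperFun n t i j)]) ∧
    (∀ i l, (c i i l l).val ≡ (c (Fin.last m) (Fin.last m) r r).val
      [MOD p ^ (n i - upperFun n t i i)]) ∧
    (∀ i l k, l ≠ k → (c i i l k).val ≡ 0 [MOD p ^ (n i - upperFun n t i i)])}

/-!
An endomorphism of `G` is determined by its matrix with respect to the basis of `G`, and all the
sets in question are described by bounds on the orders of the matrix entries: an entry of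
`ZMod (p ^ n j)` vanishes modulo `p ^ (n j - w)` exactly if it is killed by `p ^ w`. So
`orderBound e w` is the group of endomorphisms whose entries between the summands `i` and `j` are
killed by `p ^ w i j`, and `mul_mem_orderBound` reduces products to inequalities between weights.

* The Jacobson radical `𝒥` is `orderBound e (radWeight n)` (`mem_jacobson_iff_orderBound`): its
  entries within each homocyclic summand are divisible by `p`.
* The `t`-th annihilating ideal is the intersection of `𝒥` with
  `I t = orderBound e (upperFun n t)` (`mem_upperAnnSeries_iff`). The recursion of the upper
  function says precisely what multiplication by the elementary endomorphisms in `𝒥` demands.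
* The set of congruences says that `1 + a`, with `a ∈ 𝒥`, has `a` congruent modulo `I t` to the
  scalar given by a diagonal entry of `a` in the last summand (`mem_congruenceSet_iff`). That scalar
  is divisible by `p` and can be split off as a central factor (`congruenceSet_subset_mul`).

For `a ∈ I (t + 1)` and `b ∈ 𝒥` the ring commutator `a * b - b * a` lies in `I t`, hence so does
`⁅1 + a, 1 + b⁆ - 1`. This gives one inclusion for the upper central series. For the other one,
let `1 + a` be in the term `t + 1`. By induction `⁅1 + a, 1 + b⁆ - 1` is congruent to a scalar `μ`
modulo `I t`, hence `a * b - b * a` is congruent to `μ * (1 + b) * (1 + a)`, whose diagonal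
entries are `μ` times units. On the other hand, the commutator of `a` with an elementary
endomorphism `b` has at most two nonzero diagonal entries, which are opposite to each other. If
one can be found in the last summand that vanishes modulo `I t`, then `μ ∈ I t`
(`commutator_elemEnd_mem`). First this applies to `p` times the projections to basis elements, and
bounds `p` times the off-diagonal entries of `a`. This bound settles the other `b` as well, except
when the last summand is cyclic, the last gap is `1`, and `b` maps between the last two summands.
Then the two opposite entries satisfy equally strong congruences, and adding these shows
`2 * μ ∈ I t` up to a unit, which suffices for odd `p`. So all commutators `a * b - b * a` lie in
`I t`, and this forces `a` to be congruent to a scalar modulo `I (t + 1)`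
(`sub_entry_mem_upperFun_succ`).

The inequalities for the upper function come from a closed form: with `τ = t - (m - i) - (m - j)` it
is `τ` if no gap of the sequence is `1`, and otherwise the minimum of `τ` and
`e (min i j) + ⌈τ / 2⌉`, where `e k` is the truncated difference of `n k - k` and `n c - c` and `c`
is the last index with `n c - n (c - 1) = 1`. In terms of walks on pairs of indices, a step up is
free, a step down costs the gap, standing still costs `1`, and the cheapest way to spend the steps
left over is to move up and down across a gap of `1`.
-/

/-! ### Powers of a prime and divisibility -/

/-- The congruence `z ≡ 0` modulo `p ^ (N - k)`, written without subtraction as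
`p ^ N ∣ p ^ k * z`, only depends on `N - k` and gets weaker as `N - k` decreases. -/
theorem pow_dvd_pow_mul_of_le {p : ℕ} (hp : p.Prime) {N k N' k' : ℕ} {z : ℤ}
    (h : (p : ℤ) ^ N ∣ (p : ℤ) ^ k * z) (hle : N' + k ≤ N + k') :
    (p : ℤ) ^ N' ∣ (p : ℤ) ^ k' * z := by
  have hp0 : (p : ℤ) ^ k ≠ 0 := pow_ne_zero _ (by exact_mod_cast hp.ne_zero)
  have h1 : (p : ℤ) ^ (N' + k) ∣ (p : ℤ) ^ k' * ((p : ℤ) ^ k * z) :=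
    (pow_dvd_pow _ hle).trans (by
      rw [add_comm, pow_add]
      exact mul_dvd_mul_left _ h)
  rw [pow_add, mul_left_comm, mul_comm ((p : ℤ) ^ N')] at h1
  exact (mul_dvd_mul_iff_left hp0).1 h1

theorem pow_sub_dvd_iff {p : ℕ} (hp : p.Prime) (N k : ℕ) (z : ℤ) :
    (p : ℤ) ^ (N - k) ∣ z ↔ (p : ℤ) ^ N ∣ (p : ℤ) ^ k * z := by
  rcases le_total N k with h | h
  · rw [Nat.sub_eq_zero_of_le h, pow_zero]
    exact ⟨fun _ => (pow_dvd_pow _ h).mul_right z, fun _ => one_dvd z⟩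
  · constructor <;> intro h1
    · exact pow_dvd_pow_mul_of_le hp (k := 0) (by simpa using h1) (by omega)
    · simpa using pow_dvd_pow_mul_of_le hp (k' := 0) (N' := N - k) h1 (by omega)

/-- An integer prime to `p` can be cancelled from a congruence modulo a power of `p`. -/
theorem pow_dvd_of_pow_dvd_mul_of_not_dvd {p : ℕ} (hp : p.Prime) {N : ℕ} {x y : ℤ}
    (h : (p : ℤ) ^ N ∣ x * y) (hy : ¬ (p : ℤ) ∣ y) : (p : ℤ) ^ N ∣ x :=
  IsCoprime.dvd_of_dvd_mul_right
    (IsCoprime.pow_left ((Nat.prime_iff_prime_int.1 hp).coprime_iff_not_dvd.2 hy)) h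

/-! ### The upper function -/

section UpperFun

variable {m : ℕ} {n : Fin (m + 1) → ℕ}

/-- A strictly increasing sequence grows at least as fast as its index. -/
theorem add_sub_le_of_strictMono (hn : StrictMono n) {i j : Fin (m + 1)} (h : i ≤ j) :
    n i + ((j : ℕ) - i) ≤ n j := by
  obtain ⟨k, hk⟩ : ∃ k : ℕ, (j : ℕ) = i + k := ⟨j - i, by have : (i : ℕ) ≤ j := h; omega⟩
  induction k generalizing j with
  | zero =>
    have : i = j := by ext; omega
    subst this
    simp
  | succ k ih =>
    have h1 := ih (j := ⟨i + k, by omega⟩) (by rw [Fin.le_def]; simp) rfl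
    have h2 : n ⟨i + k, by omega⟩ < n j := hn (by rw [Fin.lt_def]; simp; omega)
    simp only at h1
    omega

theorem upperFun_comm (t : ℕ) (i j : Fin (m + 1)) : upperFun n t i j = upperFun n t j i := by
  induction t generalizing i j with
  | zero => rfl
  | succ t ih =>
    cases t with
    | zero => simp only [upperFun, and_comm]
    | succ t =>
      simp only [upperFun]
      rw [ih i j]
      simp only [ih i ⟨_, _⟩, ih ⟨_, _⟩ j]
      exact congrArg₂ min rfl (congrArg₂ min (min_comm _ _) (min_comm _ _))

/-- The recursion bounds the upper function by its previous values at the same and at the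
neighbouring indices. -/
theorem upperFun_succ_le_add_one (t : ℕ) (i j : Fin (m + 1)) :
    upperFun n (t + 1) i j ≤ upperFun n t i j + 1 := by
  cases t with
  | zero => simp only [upperFun]; split_ifs <;> simp
  | succ t => simp only [upperFun]; exact min_le_left _ _

theorem upperFun_succ_le_next (t : ℕ) {i i' : Fin (m + 1)} (j : Fin (m + 1))
    (h : (i' : ℕ) = i + 1) : upperFun n (t + 1) i j ≤ upperFun n t i' j := by
  have hi' := i'.isLt
  cases t with
  | zero =>
    simp only [upperFun, Fin.ext_iff, Fin.val_last]
    rw [if_neg (by omega)]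
  | succ t =>
    have h1 : (i : ℕ) < m := by omega
    have h2 : (⟨i + 1, by omega⟩ : Fin (m + 1)) = i' := by ext; simp [h]
    conv_lhs => simp only [upperFun]
    simp only [dif_pos h1, h2]
    exact (min_le_right _ _).trans ((min_le_right _ _).trans (min_le_left _ _))

theorem upperFun_succ_le_prev (hn : StrictMono n) (t : ℕ) {i i' : Fin (m + 1)} (j : Fin (m + 1))
    (h : (i : ℕ) = i' + 1) : upperFun n (t + 1) i j ≤ n i - n i' + upperFun n t i' j := by
  have hlt : n i' < n i := hn (by rw [Fin.lt_def]; omega)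
  cases t with
  | zero =>
    simp only [upperFun]
    split_ifs <;> omega
  | succ t =>
    have h1 : 0 < (i : ℕ) := by omega
    have h2 : (⟨i - 1, by omega⟩ : Fin (m + 1)) = i' := by ext; simp [h]
    conv_lhs => simp only [upperFun]
    simp only [if_pos h1, h2]
    exact (min_le_right _ _).trans ((min_le_left _ _).trans (min_le_right _ _))

/-- One of the bounds of the recursion is attained. -/
theorem upperFun_succ_eq_or (hn : StrictMono n) (t : ℕ) (i j : Fin (m + 1)) :
    upperFun n (t + 1) i j = upperFun n t i j + 1 ∨
    (∃ i' : Fin (m + 1), ((i' : ℕ) = i + 1 ∨ (i : ℕ) = i' + 1) ∧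
      upperFun n (t + 1) i j = n i - n i' + upperFun n t i' j) ∨
    (∃ j' : Fin (m + 1), ((j' : ℕ) = j + 1 ∨ (j : ℕ) = j' + 1) ∧
      upperFun n (t + 1) i j = n j - n j' + upperFun n t i j') := by
  have up : ∀ {i : Fin (m + 1)} (h : (i : ℕ) < m), n i - n ⟨i + 1, by omega⟩ = 0 := fun h =>
    Nat.sub_eq_zero_of_le (hn.monotone (by rw [Fin.le_def]; simp))
  cases t with
  | zero =>
    by_cases h : i = Fin.last m ∧ j = Fin.last m
    · left
      simp [upperFun, h]
    · right
      rw [not_and_or] at h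
      simp only [upperFun, not_and_or.2 h, if_false]
      simp only [Fin.ext_iff, Fin.val_last] at h
      rcases h with h | h
      · exact Or.inl ⟨⟨i + 1, by omega⟩, Or.inl rfl, by rw [up (by omega)]⟩
      · exact Or.inr ⟨⟨j + 1, by omega⟩, Or.inl rfl, by rw [up (by omega)]⟩
  | succ t =>
    have key : ∀ x a b c d e : ℕ, x = min a (min (min b c) (min d e)) →
        x = a ∨ x = b ∨ x = c ∨ x = d ∨ x = e := by omega
    generalize hx : upperFun n (t + 1 + 1) i j = x
    have h := hx.symm
    simp only [upperFun] at h
    rcases key _ _ _ _ _ _ h with h | h | h | h | h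
    · exact Or.inl h
    · split_ifs at h with h0
      · exact Or.inr (Or.inr ⟨_, Or.inr (by simp; omega), h⟩)
      · exact Or.inl h
    · split_ifs at h with h0
      · exact Or.inr (Or.inl ⟨_, Or.inr (by simp; omega), h⟩)
      · exact Or.inl h
    · split_ifs at h with h0
      · exact Or.inr (Or.inl ⟨_, Or.inl rfl, by rw [h, up h0, zero_add]⟩)
      · exact Or.inl h
    · split_ifs at h with h0
      · exact Or.inr (Or.inr ⟨_, Or.inl rfl, by rw [h, up h0, zero_add]⟩)
      · exact Or.inl h

/-- A function that is symmetric and satisfies the bounds of the recursion is the upper function, if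
one of the bounds is attained; by symmetry this only has to be checked for `i ≤ j`. -/
theorem upperFun_eq_of_recursion (hn : StrictMono n) (F : ℕ → Fin (m + 1) → Fin (m + 1) → ℕ)
    (h0 : ∀ i j, F 0 i j = 0) (hcomm : ∀ t i j, F t i j = F t j i)
    (hstay : ∀ t i j, F (t + 1) i j ≤ F t i j + 1)
    (hnext : ∀ t (i i' j : Fin (m + 1)), (i' : ℕ) = i + 1 → F (t + 1) i j ≤ F t i' j)
    (hprev : ∀ t (i i' j : Fin (m + 1)), (i : ℕ) = i' + 1 → F (t + 1) i j ≤ n i - n i' + F t i' j)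
    (hattain : ∀ t (i j : Fin (m + 1)), i ≤ j → F t i j + 1 ≤ F (t + 1) i j ∨
      (∃ i' : Fin (m + 1), (i' : ℕ) = i + 1 ∧ F t i' j ≤ F (t + 1) i j) ∨
      (∃ i' : Fin (m + 1), (i : ℕ) = i' + 1 ∧ n i - n i' + F t i' j ≤ F (t + 1) i j) ∨
      (∃ j' : Fin (m + 1), (j' : ℕ) = j + 1 ∧ F t i j' ≤ F (t + 1) i j))
    (t : ℕ) (i j : Fin (m + 1)) : upperFun n t i j = F t i j := by
  induction t generalizing i j with
  | zero => exact (h0 i j).symm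
  | succ t ih =>
    apply le_antisymm
    · wlog hij : i ≤ j generalizing i j
      · rw [upperFun_comm, hcomm]
        exact this j i (le_of_not_ge hij)
      rcases hattain t i j hij with h | ⟨i', hi, h⟩ | ⟨i', hi, h⟩ | ⟨j', hj, h⟩
      · exact (upperFun_succ_le_add_one t i j).trans (by rwa [ih])
      · exact (upperFun_succ_le_next t j hi).trans (by rwa [ih])
      · exact (upperFun_succ_le_prev hn t j hi).trans (by rwa [ih])
      · rw [upperFun_comm]
        exact (upperFun_succ_le_next t i hj).trans (by rwa [ih, hcomm])
    · rcases upperFun_succ_eq_or hn t i j with h | ⟨i', hi, h⟩ | ⟨j', hj, h⟩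
      · rw [h, ih]
        exact hstay t i j
      · rw [h, ih]
        rcases hi with hi | hi
        · exact (hnext t i i' j hi).trans (Nat.le_add_left _ _)
        · exact hprev t i i' j hi
      · rw [h, ih, hcomm, hcomm t]
        rcases hj with hj | hj
        · exact (hnext t j j' i hj).trans (Nat.le_add_left _ _)
        · exact hprev t j j' i hj

/-- Closed form of the upper function of a sequence without a gap equal to `1`. -/
theorem upperFun_eq_of_two_le_gap (hn : StrictMono n)
    (hgap : ∀ i j : Fin (m + 1), (j : ℕ) = i + 1 → n i + 2 ≤ n j) (t : ℕ) (i j : Fin (m + 1)) :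
    upperFun n t i j = t - (m - i) - (m - j) := by
  refine upperFun_eq_of_recursion hn (fun t i j => t - (m - i) - (m - j)) ?_ ?_ ?_ ?_ ?_ ?_ t i j
  · intros; simp
  · intros; omega
  · intros; omega
  · intros; omega
  · intro t i i' j h
    have := hgap _ _ h
    omega
  · intro t i j hij
    have hi := i.isLt
    have hj := j.isLt
    rw [Fin.le_def] at hij
    by_cases h : (i : ℕ) < m
    · right; left
      refine ⟨⟨i + 1, by omega⟩, rfl, ?_⟩
      simp only
      omega
    · left
      omega

/-- Closed form of the upper function of a sequence where `c` is the last index with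
`n c - n (c - 1) = 1`. -/
theorem upperFun_eq_of_last_unit_gap (hn : StrictMono n) {c d : Fin (m + 1)}
    (hdc : (c : ℕ) = d + 1) (hc : n c = n d + 1)
    (hgap : ∀ i j : Fin (m + 1), c ≤ i → (j : ℕ) = i + 1 → n i + 2 ≤ n j)
    (t : ℕ) (i j : Fin (m + 1)) :
    upperFun n t i j = min (t - (m - i) - (m - j))
      ((n (min i j) + c) - (n c + (min i j : Fin (m + 1)))
        + (t - (m - i) - (m - j) + 1) / 2) := by
  have mono : ∀ {i j : Fin (m + 1)}, i ≤ j → n i + ((j : ℕ) - i) ≤ n j :=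
    add_sub_le_of_strictMono hn
  have hc0 : ∀ {i : Fin (m + 1)}, i ≤ c → n i + c ≤ n c + i := by
    intro i h1
    have := mono h1
    rw [Fin.le_def] at h1
    omega
  have hmin : ∀ i j : Fin (m + 1), i ≤ j → min i j = i := fun i j h => min_eq_left h
  have hmin' : ∀ i j : Fin (m + 1), j ≤ i → min i j = j := fun i j h => min_eq_right h
  -- the excess of `n k - k` over `n c - c` increases with `k`, by at most the gap minus one
  have e1 : ∀ {i i' : Fin (m + 1)} (j : Fin (m + 1)), (i' : ℕ) = i + 1 →
      (n (min i j) + c) - (n c + (min i j : Fin (m + 1))) ≤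
        (n (min i' j) + c) - (n c + (min i' j : Fin (m + 1))) := by
    intro i i' j h
    have h1 : min i j ≤ min i' j := min_le_min_right j (by rw [Fin.le_def]; omega)
    have := mono h1
    rw [Fin.le_def] at h1
    omega
  have e2 : ∀ {i i' : Fin (m + 1)} (j : Fin (m + 1)), (i' : ℕ) = i + 1 →
      (n (min i' j) + c) - (n c + (min i' j : Fin (m + 1))) + 1 ≤ (n i' - n i) +
        ((n (min i j) + c) - (n c + (min i j : Fin (m + 1)))) := by
    intro i i' j h
    have h1 : i ≤ i' := by rw [Fin.le_def]; omega
    have h2 := mono h1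
    rcases le_or_gt i' j with hj | hj
    · rw [hmin _ _ hj, hmin _ _ (h1.trans hj)]
      omega
    · have hj' : j ≤ i := by rw [Fin.le_def, Fin.lt_def] at *; omega
      rw [hmin' _ _ hj.le, hmin' _ _ hj']
      omega
  -- a gap equal to `1` can only occur up to `c`, where the excess vanishes
  have e3 : ∀ {i i' : Fin (m + 1)} (j : Fin (m + 1)), (i' : ℕ) = i + 1 → n i' = n i + 1 →
      (n (min i' j) + c) - (n c + (min i' j : Fin (m + 1))) = 0 := by
    intro i i' j h h'
    have h1 : i' ≤ c := by
      by_contra hcon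
      have := hgap i i' (by rw [Fin.le_def] at *; omega) h
      omega
    have := hc0 (le_trans (min_le_left i' j) h1)
    omega
  refine upperFun_eq_of_recursion hn (fun t i j => min (t - (m - i) - (m - j))
      ((n (min i j) + c) - (n c + (min i j : Fin (m + 1)))
        + (t - (m - i) - (m - j) + 1) / 2)) ?_ ?_ ?_ ?_ ?_ ?_ t i j
  · intros; simp
  · intro t i j
    rw [min_comm i j]
    have : t - (m - (i : ℕ)) - (m - j) = t - (m - j) - (m - i) := by omega
    simp only [this]
  · intro t i j
    generalize (n (min i j) + (c : ℕ)) - _ = e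
    omega
  · intro t i i' j h
    have h1 := e1 j h
    generalize (n (min i j) + (c : ℕ)) - _ = e at *
    generalize (n (min i' j) + (c : ℕ)) - _ = e' at *
    have : t + 1 - (m - (i : ℕ)) - (m - j) ≤ t - (m - i') - (m - j) := by omega
    omega
  · intro t i i' j h
    have h1 := e2 j h
    have h2 := e3 j h
    have h3 := mono (i := i') (j := i) (by rw [Fin.le_def]; omega)
    generalize (n (min i j) + (c : ℕ)) - _ = e at *
    generalize (n (min i' j) + (c : ℕ)) - _ = e' at *
    have : t + 1 - (m - (i : ℕ)) - (m - j) ≤ t - (m - i') - (m - j) + 2 := by omega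
    have h4 : (i' : ℕ) < i := by omega
    have h5 : t - (m - (i' : ℕ)) - (m - j) = t + 1 - (m - i) - (m - j) - 2 := by omega
    simp only [h5]
    generalize t + 1 - (m - (i : ℕ)) - (m - j) = τ
    by_cases hD : n i = n i' + 1
    · rw [h2 hD] at *
      omega
    · omega
  · intro t i j hij
    have hi := i.isLt
    have hj := j.isLt
    have hm := hmin i j hij
    rw [Fin.le_def] at hij
    simp only [hm]
    rcases Nat.eq_zero_or_pos (t + 1 - (m - (i : ℕ)) - (m - j)) with h0 | h0
    · right; left
      refine ⟨⟨i + 1, by omega⟩, rfl, ?_⟩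
      simp only
      omega
    rcases lt_or_ge i c with hic | hic
    · right; left
      have h1 := hic
      rw [Fin.lt_def] at h1
      refine ⟨⟨i + 1, by omega⟩, rfl, ?_⟩
      have h2 := hc0 (i := min ⟨i + 1, by omega⟩ j) ((min_le_left _ _).trans
        (by rw [Fin.le_def]; simpa using h1))
      have h3 := Nat.sub_eq_zero_of_le h2
      simp only [h3]
      omega
    · rcases le_or_gt (t + 1 - (m - (i : ℕ)) - (m - j))
        (n i + c - (n c + i) + (t + 1 - (m - (i : ℕ)) - (m - j) + 1) / 2) with hle | hlt
      · left
        rw [min_eq_left hle]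
        omega
      · right; right; left
        have hic' := hic
        rw [Fin.le_def] at hic'
        have h2 : n ⟨i - 1, by omega⟩ < n i := hn (by rw [Fin.lt_def]; dsimp only; omega)
        refine ⟨⟨i - 1, by omega⟩, by simp; omega, ?_⟩
        rw [min_eq_right hlt.le, hmin ⟨i - 1, by omega⟩ j (by rw [Fin.le_def]; simp; omega)]
        have h1 := mono hic
        rcases eq_or_lt_of_le hic with hci | hci
        · subst hci
          have : (⟨c - 1, by omega⟩ : Fin (m + 1)) = d := by ext; simp [hdc]
          simp only [this]
          omega
        · rw [Fin.lt_def] at hci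
          have h3 := mono (i := c) (j := ⟨i - 1, by omega⟩) (by rw [Fin.le_def]; simp; omega)
          simp only at h3 ⊢
          omega

/-- Either all gaps are at least `2`, or there is a last gap equal to `1`. -/
theorem two_le_gap_or_exists_last_unit_gap (hn : StrictMono n) :
    (∀ i j : Fin (m + 1), (j : ℕ) = i + 1 → n i + 2 ≤ n j) ∨
    ∃ c d : Fin (m + 1), (c : ℕ) = d + 1 ∧ n c = n d + 1 ∧
      ∀ i j : Fin (m + 1), c ≤ i → (j : ℕ) = i + 1 → n i + 2 ≤ n j := by
  classical
  rw [or_iff_not_imp_left]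
  intro h
  push Not at h
  have hlt : ∀ i j : Fin (m + 1), (j : ℕ) = i + 1 → n i < n j := fun i j h =>
    hn (by rw [Fin.lt_def]; omega)
  let S : Finset (Fin (m + 1)) :=
    Finset.univ.filter fun c => ∃ d : Fin (m + 1), (c : ℕ) = d + 1 ∧ n c = n d + 1
  have hS : S.Nonempty := by
    obtain ⟨i, j, hij, h⟩ := h
    refine ⟨j, Finset.mem_filter.2 ⟨Finset.mem_univ _, i, hij, ?_⟩⟩
    have := hlt i j hij
    omega
  obtain ⟨d, h1, h2⟩ := (Finset.mem_filter.1 (S.max'_mem hS)).2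
  refine ⟨S.max' hS, d, h1, h2, fun i j hci hij => ?_⟩
  by_contra hcon
  have := hlt i j hij
  have hj : j ∈ S := Finset.mem_filter.2 ⟨Finset.mem_univ _, i, hij, by omega⟩
  have := S.le_max' j hj
  rw [Fin.le_def] at this hci
  omega

theorem upperFun_mono (hn : StrictMono n) (t : ℕ) {i i' : Fin (m + 1)} (j : Fin (m + 1))
    (h : i ≤ i') : upperFun n t i j ≤ upperFun n t i' j := by
  have h' := h
  rw [Fin.le_def] at h'
  rcases two_le_gap_or_exists_last_unit_gap hn with hgap | ⟨c, d, hdc, hc, hgap⟩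
  · simp only [upperFun_eq_of_two_le_gap hn hgap]
    omega
  · simp only [upperFun_eq_of_last_unit_gap hn hdc hc hgap]
    have h1 : min i j ≤ min i' j := min_le_min_right j h
    have h2 := add_sub_le_of_strictMono hn h1
    rw [Fin.le_def] at h1
    have h3 : t - (m - (i : ℕ)) - (m - j) ≤ t - (m - i') - (m - j) := by omega
    omega

theorem upperFun_le_add_sub_of_le (hn : StrictMono n) (t : ℕ) {i i' : Fin (m + 1)} (j : Fin (m + 1))
    (h : i' ≤ i) : upperFun n t i j ≤ upperFun n t i' j + (n i - n i') := by
  have h0 := add_sub_le_of_strictMono hn h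
  have h' := h
  rw [Fin.le_def] at h'
  have h3 : t - (m - (i : ℕ)) - (m - j) ≤ t - (m - i') - (m - j) + (i - i') := by omega
  rcases two_le_gap_or_exists_last_unit_gap hn with hgap | ⟨c, d, hdc, hc, hgap⟩
  · simp only [upperFun_eq_of_two_le_gap hn hgap]
    omega
  · simp only [upperFun_eq_of_last_unit_gap hn hdc hc hgap]
    have h1 : n (min i j) + c - (n c + (min i j : Fin (m + 1))) + (i - i') ≤
        n (min i' j) + c - (n c + (min i' j : Fin (m + 1))) + (n i - n i') := by
      rcases le_total i j with hj | hj
      · rw [min_eq_left hj, min_eq_left (h.trans hj)]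
        omega
      · rw [min_eq_right hj]
        have h2 := add_sub_le_of_strictMono hn (min_le_right i' j)
        rcases le_total i' j with hj' | hj'
        · rw [min_eq_left hj'] at *
          have h4 := add_sub_le_of_strictMono hn hj
          rw [Fin.le_def] at hj hj'
          omega
        · rw [min_eq_right hj'] at *
          omega
    omega

theorem upperFun_le_add_sub (hn : StrictMono n) (t : ℕ) (i i' j : Fin (m + 1)) :
    upperFun n t i j ≤ upperFun n t i' j + (n i - n i') := by
  rcases le_total i i' with h | h
  · exact (upperFun_mono hn t j h).trans (Nat.le_add_right _ _)
  · exact upperFun_le_add_sub_of_le hn t j h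

/-- The recursive bounds, extended from neighbouring indices to all others. -/
theorem upperFun_succ_le_of_ne (hn : StrictMono n) (t : ℕ) {i k : Fin (m + 1)} (j : Fin (m + 1))
    (h : i ≠ k) : upperFun n (t + 1) k j ≤ upperFun n t i j + (n k - n i) := by
  rcases lt_or_gt_of_ne h with h | h <;> rw [Fin.lt_def] at h
  · have h1 : (k : ℕ) = (⟨k - 1, by omega⟩ : Fin (m + 1)) + 1 := by dsimp only; omega
    have h2 := upperFun_succ_le_prev hn t j h1
    have hle : i ≤ (⟨k - 1, by omega⟩ : Fin (m + 1)) := by rw [Fin.le_def]; dsimp only; omega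
    have h3 := upperFun_le_add_sub_of_le hn t j hle
    have h4 := add_sub_le_of_strictMono hn hle
    have h5 : n ⟨k - 1, by omega⟩ < n k := hn (by rw [Fin.lt_def]; dsimp only; omega)
    omega
  · have hi := i.isLt
    have h1 : ((⟨k + 1, by omega⟩ : Fin (m + 1)) : ℕ) = k + 1 := rfl
    exact (upperFun_succ_le_next t j h1).trans
      ((upperFun_mono hn t j (by rw [Fin.le_def]; dsimp only; omega)).trans (Nat.le_add_right _ _))

/-- On the diagonal the exponents `n i - α (i, i, t)` increase with `i`. This makes a scalar that
satisfies the congruence of the last summand satisfy all congruences on the diagonal. -/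
theorem upperFun_diag_le (hn : StrictMono n) (t : ℕ) {i j : Fin (m + 1)} (h : i ≤ j) :
    upperFun n t j j ≤ upperFun n t i i + (n j - n i) := by
  have adj : ∀ i j : Fin (m + 1), (j : ℕ) = i + 1 →
      upperFun n t j j ≤ upperFun n t i i + (n j - n i) := by
    intro i j h
    have hij : i ≤ j := by rw [Fin.le_def]; omega
    have h0 := add_sub_le_of_strictMono hn hij
    have h3 : t - (m - (i : ℕ)) - (m - i) = t - (m - j) - (m - j) - 2 := by omega
    rcases two_le_gap_or_exists_last_unit_gap hn with hgap | ⟨c, d, hdc, hc, hgap⟩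
    · simp only [upperFun_eq_of_two_le_gap hn hgap]
      have := hgap i j h
      omega
    · simp only [upperFun_eq_of_last_unit_gap hn hdc hc hgap, min_self, h3]
      generalize t - (m - (j : ℕ)) - (m - j) = τ
      rcases lt_or_ge i c with hic | hic
      · have h4 : j ≤ c := by rw [Fin.le_def]; rw [Fin.lt_def] at hic; omega
        have h5 := add_sub_le_of_strictMono hn h4
        rw [Fin.le_def] at h4
        omega
      · have := hgap i j hic h
        omega
  obtain ⟨k, hk⟩ : ∃ k : ℕ, (j : ℕ) = i + k := ⟨j - i, by rw [Fin.le_def] at h; omega⟩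
  induction k generalizing j with
  | zero =>
    obtain rfl : i = j := by ext; omega
    simp
  | succ k ih =>
    have hle : i ≤ (⟨i + k, by omega⟩ : Fin (m + 1)) := by rw [Fin.le_def]; simp
    have h1 := ih (j := ⟨i + k, by omega⟩) hle rfl
    have h2 := adj ⟨i + k, by omega⟩ j (by dsimp only; omega)
    have h3 := add_sub_le_of_strictMono hn hle
    have h4 : n ⟨i + k, by omega⟩ < n j := hn (by rw [Fin.lt_def]; dsimp only; omega)
    omega

/-- Below the last summand, the upper function on the diagonal is given by the step to the next
index. -/
theorem upperFun_succ_diag (hn : StrictMono n) (t : ℕ) {i i' : Fin (m + 1)}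
    (h : (i' : ℕ) = i + 1) : upperFun n (t + 1) i i = upperFun n t i' i := by
  have hi' := i'.isLt
  rcases two_le_gap_or_exists_last_unit_gap hn with hgap | ⟨c, d, hdc, hc, hgap⟩
  · simp only [upperFun_eq_of_two_le_gap hn hgap]
    omega
  · have hm : min i' i = i := min_eq_right (by rw [Fin.le_def]; omega)
    simp only [upperFun_eq_of_last_unit_gap hn hdc hc hgap, hm, min_self]
    have : t + 1 - (m - (i : ℕ)) - (m - i) = t - (m - i') - (m - i) := by omega
    rw [this]

/-- In the last column the upper function increases strictly towards the last row, unless the last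
gap is `1`. In that case the congruences on the diagonal are at least as strong in the summand
before the last one as in the last one. -/
theorem upperFun_last_lt_or (hn : StrictMono n) {t : ℕ} (ht : 1 ≤ t) {j : Fin (m + 1)}
    (hj : j ≠ Fin.last m) :
    upperFun n t j (Fin.last m) + 1 ≤ upperFun n t (Fin.last m) (Fin.last m) ∨
    ((j : ℕ) + 1 = m ∧ n (Fin.last m) = n j + 1 ∧ n (Fin.last m) + upperFun n t j j ≤
      n j + upperFun n t (Fin.last m) (Fin.last m)) := by
  have hlt := lt_of_le_of_ne (Fin.le_last j) hj
  have hjm : (j : ℕ) < m := by simpa [Fin.lt_def] using hlt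
  have hmin : min j (Fin.last m) = j := min_eq_left hlt.le
  have h0 := add_sub_le_of_strictMono hn hlt.le
  rw [Fin.val_last] at h0
  rcases two_le_gap_or_exists_last_unit_gap hn with hgap | ⟨c, d, hdc, hc, hgap⟩
  · simp only [upperFun_eq_of_two_le_gap hn hgap, Fin.val_last]
    omega
  · simp only [upperFun_eq_of_last_unit_gap hn hdc hc hgap, min_self, hmin, Fin.val_last]
    have hcm : (c : ℕ) ≤ m := by omega
    by_cases hj1 : (j : ℕ) + 1 = m
    · rcases eq_or_lt_of_le hcm with hcm | hcm
      · obtain rfl : j = d := by ext; omega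
        obtain rfl : c = Fin.last m := by ext; simpa using hcm
        simp only [Fin.val_last] at *
        omega
      · have hcj : c ≤ j := by rw [Fin.le_def]; omega
        have h1 := add_sub_le_of_strictMono hn hcj
        have h2 := hgap j (Fin.last m) hcj (by simp; omega)
        rw [Fin.le_def] at hcj
        left
        omega
    · left
      omega

end UpperFun

/-! ### Coordinates and matrix entries -/

theorem ZMod.pow_smul_eq_zero_iff {p N : ℕ} {c : ZMod (p ^ N)} {z : ℤ}
    (h : (z : ZMod (p ^ N)) = c) (a : ℕ) : p ^ a • c = 0 ↔ (p : ℤ) ^ N ∣ (p : ℤ) ^ a * z := by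
  have : p ^ a • c = (((p : ℤ) ^ a * z : ℤ) : ZMod (p ^ N)) := by
    rw [nsmul_eq_mul, ← h]
    push_cast
    rfl
  rw [this, ZMod.intCast_zmod_eq_zero_iff_dvd]
  push_cast
  rfl

section Coordinates

variable {m p : ℕ} {n : Fin (m + 1) → ℕ} {κ : Fin (m + 1) → Type u} {G : Type v} [AddCommGroup G]
  (e : G ≃+ HomocyclicSum p n κ)

/-- The basis element of `G` at the index `u.2` of the summand `u.1`. -/
noncomputable def basisVec (u : Σ i, κ i) : G :=
  e.symm (DirectSum.of (fun i => κ i →₀ ZMod (p ^ n i)) u.1 (Finsupp.single u.2 1))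

/-- The coefficient at a basis element. -/
noncomputable def coord (v : Σ i, κ i) : G →+ ZMod (p ^ n v.1) :=
  AddMonoidHom.mk' (fun g => e g v.1 v.2) (by intro a b; simp)

theorem coord_apply (v : Σ i, κ i) (g : G) : coord e v g = e g v.1 v.2 := rfl

theorem matrixEntry_eq_coord (f : AddMonoid.End G) (i j : Fin (m + 1)) (l : κ i) (k : κ j) :
    matrixEntry e f i j l k = coord e ⟨j, k⟩ (f (basisVec e ⟨i, l⟩)) := rfl

theorem coord_basisVec_self (u : Σ i, κ i) : coord e u (basisVec e u) = 1 := by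
  simp [coord_apply, basisVec]

theorem coord_basisVec_of_ne {u v : Σ i, κ i} (h : v ≠ u) : coord e v (basisVec e u) = 0 := by
  obtain ⟨i, l⟩ := u
  obtain ⟨j, k⟩ := v
  simp only [coord_apply, basisVec, AddEquiv.apply_symm_apply]
  by_cases hij : i = j
  · subst hij
    have hlk : k ≠ l := fun hkl => h (by rw [hkl])
    rw [DirectSum.of_eq_same, Finsupp.single_eq_of_ne hlk]
  · rw [DirectSum.of_eq_of_ne _ _ _ (Ne.symm hij)]
    rfl

theorem eq_of_coord_eq {g h : G} (H : ∀ v, coord e v g = coord e v h) : g = h := by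
  apply e.injective
  ext j k
  exact H ⟨j, k⟩

theorem pow_smul_basisVec (u : Σ i, κ i) : p ^ n u.1 • basisVec e u = 0 := by
  rw [basisVec, ← map_nsmul, ← map_nsmul, Finsupp.smul_single]
  have : (p ^ n u.1) • (1 : ZMod (p ^ n u.1)) = 0 := by
    rw [nsmul_eq_mul, mul_one, ZMod.natCast_self]
  rw [this]
  simp

theorem coord_intCast_self (μ : ℤ) (u : Σ i, κ i) :
    coord e u ((μ : AddMonoid.End G) (basisVec e u)) = (μ : ZMod (p ^ n u.1)) := by
  rw [AddMonoid.End.intCast_apply, map_zsmul, coord_basisVec_self, zsmul_one]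

theorem coord_intCast_of_ne (μ : ℤ) {u v : Σ i, κ i} (h : u ≠ v) :
    coord e v ((μ : AddMonoid.End G) (basisVec e u)) = 0 := by
  rw [AddMonoid.End.intCast_apply, map_zsmul, coord_basisVec_of_ne e h.symm, smul_zero]

/-! ### Endomorphisms with bounded orders of entries -/

/-- The group of endomorphisms whose entry between the summands `i` and `j` has order at most
`p ^ w i j`, that is, vanishes modulo `p ^ (n j - w i j)`. -/
def orderBound (w : Fin (m + 1) → Fin (m + 1) → ℕ) : AddSubgroup (AddMonoid.End G) where
  carrier := {f | ∀ u v, p ^ w u.1 v.1 • coord e v (f (basisVec e u)) = 0}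
  zero_mem' := by intro u v; simp
  add_mem' := by
    intro f g hf hg u v
    change _ • coord e v (f (basisVec e u) + g (basisVec e u)) = 0
    rw [map_add, smul_add, hf u v, hg u v, add_zero]
  neg_mem' := by
    intro f hf u v
    change _ • coord e v (-f (basisVec e u)) = 0
    rw [map_neg, smul_neg, hf u v, neg_zero]

theorem orderBound_mono {w w' : Fin (m + 1) → Fin (m + 1) → ℕ} (h : ∀ i j, w i j ≤ w' i j) :
    orderBound e w ≤ orderBound e w' := by
  intro f hf u v
  rw [← Nat.sub_add_cancel (h u.1 v.1), pow_add, mul_smul, hf u v, smul_zero]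

/-- Every endomorphism maps a basis element to an element whose order is at most that of the basis
element. -/
theorem mem_orderBound_min (f : AddMonoid.End G) :
    f ∈ orderBound e (fun i j => min (n i) (n j)) := by
  intro u v
  change p ^ min (n u.1) (n v.1) • _ = _
  rcases le_total (n u.1) (n v.1) with h | h
  · rw [min_eq_left h, ← map_nsmul, ← map_nsmul, pow_smul_basisVec, map_zero, map_zero]
  · rw [min_eq_right h, nsmul_eq_mul, ZMod.natCast_self, zero_mul]

theorem zmultiplesHom_pow_smul_basisVec_eq_zero (u v : Σ i, κ i) :
    zmultiplesHom G (p ^ (n v.1 - n u.1) • basisVec e v) (p ^ n u.1 : ℕ) = 0 := by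
  rw [zmultiplesHom_apply, natCast_zsmul, ← mul_smul, ← pow_add,
    show n u.1 + (n v.1 - n u.1) = (n u.1 - n v.1) + n v.1 by omega, pow_add, mul_smul,
    pow_smul_basisVec, smul_zero]

variable [hp : Fact p.Prime]

/-- The element `g` is the sum of its components along the basis. -/
theorem mem_closure_coord_smul_basisVec (g : G) :
    g ∈ AddSubgroup.closure (Set.range fun w => (coord e w g).val • basisVec e w) := by
  have h1 : g = ∑ i, (e g i).sum fun l c =>
      e.symm (DirectSum.of (fun i => κ i →₀ ZMod (p ^ n i)) i (Finsupp.single l c)) := by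
    apply e.injective
    rw [map_sum]
    conv_lhs => rw [← DirectSum.sum_univ_of (e g)]
    refine Finset.sum_congr rfl fun i _ => ?_
    rw [Finsupp.sum, map_sum]
    simp only [AddEquiv.apply_symm_apply]
    rw [← map_sum]
    congr 1
    exact (Finsupp.sum_single (e g i)).symm
  have h2 : ∀ i l, (coord e ⟨i, l⟩ g).val • basisVec e ⟨i, l⟩ =
      e.symm (DirectSum.of (fun i => κ i →₀ ZMod (p ^ n i)) i (Finsupp.single l (e g i l))) := by
    intro i l
    rw [basisVec, ← map_nsmul, ← map_nsmul, Finsupp.smul_single, nsmul_eq_mul, mul_one,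
      ZMod.natCast_zmod_val]
    rfl
  generalize hS : AddSubgroup.closure
    (Set.range fun w => (coord e w g).val • basisVec e w) = S
  rw [h1]
  refine sum_mem fun i _ => sum_mem fun l _ => ?_
  change e.symm _ ∈ S
  rw [← h2, ← hS]
  exact AddSubgroup.subset_closure ⟨⟨i, l⟩, rfl⟩

/-- A coordinate of `f g` is a sum of the products of the coordinates of `g` with those of the
images of the basis elements. -/
theorem smul_coord_map_eq_zero {f : AddMonoid.End G} {g : G} {v : Σ i, κ i} {k : ℕ}
    (h : ∀ w, k • ((coord e w g).val • coord e v (f (basisVec e w))) = 0) :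
    k • coord e v (f g) = 0 := by
  have hg := mem_closure_coord_smul_basisVec e g
  have hle : AddSubgroup.closure (Set.range fun w => (coord e w g).val • basisVec e w) ≤
      ((k • ((coord e v).comp f) : G →+ ZMod (p ^ n v.1))).ker := by
    rw [AddSubgroup.closure_le]
    rintro _ ⟨w, rfl⟩
    have : k • coord e v (f ((coord e w g).val • basisVec e w)) = 0 := by
      rw [map_nsmul, map_nsmul]
      exact h w
    exact this
  exact hle hg

/-- The matrix entry of `f` at two basis elements, as the representative in `[0, p ^ n)`. -/
noncomputable def entry (f : AddMonoid.End G) (u v : Σ i, κ i) : ℤ :=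
  ((coord e v (f (basisVec e u))).val : ℤ)

theorem intCast_entry (f : AddMonoid.End G) (u v : Σ i, κ i) :
    (entry e f u v : ZMod (p ^ n v.1)) = coord e v (f (basisVec e u)) := by
  simp [entry]

theorem mem_orderBound_iff_dvd {w : Fin (m + 1) → Fin (m + 1) → ℕ} {f : AddMonoid.End G} :
    f ∈ orderBound e w ↔
      ∀ u v, (p : ℤ) ^ n v.1 ∣ (p : ℤ) ^ w u.1 v.1 * entry e f u v :=
  forall₂_congr fun u v => ZMod.pow_smul_eq_zero_iff (intCast_entry e f u v) _

/-- An entry of `f * g` is a sum of products over an intermediate basis element, say in the summand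
`k`, where the entry of `g` contributes the valuation `n k - w' i k`. -/
theorem mul_mem_orderBound {w w' w'' : Fin (m + 1) → Fin (m + 1) → ℕ} {f g : AddMonoid.End G}
    (hf : f ∈ orderBound e w) (hg : g ∈ orderBound e w')
    (h : ∀ i k j, w k j ≤ w'' i j + (n k - w' i k)) : f * g ∈ orderBound e w'' := by
  intro u v
  change _ • coord e v (f (g (basisVec e u))) = 0
  refine smul_coord_map_eq_zero e fun z => ?_
  have hf' := (mem_orderBound_iff_dvd e).1 hf z v
  have hg' := (mem_orderBound_iff_dvd e).1 hg u z
  have hc : ((entry e g u z * entry e f z v : ℤ) : ZMod (p ^ n v.1)) =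
      (coord e z (g (basisVec e u))).val • coord e v (f (basisVec e z)) := by
    push_cast
    rw [intCast_entry, nsmul_eq_mul, entry]
    simp
  have := h u.1 z.1 v.1
  refine (ZMod.pow_smul_eq_zero_iff hc _).2 ?_
  have h1 : (p : ℤ) ^ (n z.1 - w' u.1 z.1) ∣ entry e g u z := by
    rcases le_total (n z.1) (w' u.1 z.1) with hle | hle
    · simp [Nat.sub_eq_zero_of_le hle]
    · simpa using pow_dvd_pow_mul_of_le hp.out (k' := 0) hg' (by omega)
  obtain ⟨y, hy⟩ := h1
  rw [hy, mul_assoc, ← mul_assoc, ← pow_add, mul_comm y, ← mul_assoc]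
  exact (pow_dvd_pow_mul_of_le hp.out hf' (by omega)).mul_right y

theorem eq_zero_of_mem_orderBound_zero {f : AddMonoid.End G}
    (hf : f ∈ orderBound e (fun _ _ => 0)) : f = 0 := by
  refine AddMonoidHom.ext fun g => eq_of_coord_eq e fun v => ?_
  have : 1 • coord e v (f g) = 0 := smul_coord_map_eq_zero e fun w => by
    have h := hf w v
    rw [pow_zero, one_smul] at h
    rw [h, smul_zero, smul_zero]
  rw [one_smul] at this
  exact this.trans (map_zero _).symm

/-! ### Elementary endomorphisms -/

/-- The elementary endomorphism that maps the basis element at `u` to the multiple of the basis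
element at `v` by the smallest power of `p` such that its order divides that of the former, and all
other basis elements to zero. The truncated subtraction makes that power `1` if the summand of `v`
has the smaller exponent. -/
noncomputable def elemEnd (u v : Σ i, κ i) : AddMonoid.End G :=
  AddMonoidHom.comp (ZMod.lift (p ^ n u.1)
    ⟨zmultiplesHom G (p ^ (n v.1 - n u.1) • basisVec e v),
      zmultiplesHom_pow_smul_basisVec_eq_zero e u v⟩) (coord e u)

theorem elemEnd_apply (u v : Σ i, κ i) (g : G) :
    elemEnd e u v g = (coord e u g).val • (p ^ (n v.1 - n u.1) • basisVec e v) := by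
  have h : (((coord e u g).val : ℤ) : ZMod (p ^ n u.1)) = coord e u g := by simp
  have h' := ZMod.lift_coe (p ^ n u.1) (A := G)
    ⟨zmultiplesHom G (p ^ (n v.1 - n u.1) • basisVec e v),
      zmultiplesHom_pow_smul_basisVec_eq_zero e u v⟩ (coord e u g).val
  rw [h, zmultiplesHom_apply, natCast_zsmul] at h'
  exact h'

theorem coord_elemEnd_self (u v : Σ i, κ i) (f : AddMonoid.End G) (w : Σ i, κ i) :
    coord e v (elemEnd e u v (f (basisVec e w))) =
      ((p ^ (n v.1 - n u.1) * entry e f w u : ℤ) : ZMod (p ^ n v.1)) := by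
  rw [elemEnd_apply, map_nsmul, map_nsmul, coord_basisVec_self, entry]
  simp [mul_comm]

theorem coord_elemEnd_of_ne {u v z : Σ i, κ i} (h : z ≠ v) (g : G) :
    coord e z (elemEnd e u v g) = 0 := by
  rw [elemEnd_apply, map_nsmul, map_nsmul, coord_basisVec_of_ne e h, smul_zero, smul_zero]

theorem elemEnd_basisVec_of_ne {u v w : Σ i, κ i} (h : w ≠ u) :
    elemEnd e u v (basisVec e w) = 0 := by
  rw [elemEnd_apply, coord_basisVec_of_ne e h.symm, ZMod.val_zero, zero_smul]

theorem elemEnd_basisVec_self (u v : Σ i, κ i) (hu : 0 < n u.1) :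
    elemEnd e u v (basisVec e u) = p ^ (n v.1 - n u.1) • basisVec e v := by
  have : Fact (1 < p ^ n u.1) := ⟨Nat.one_lt_pow hu.ne' hp.out.one_lt⟩
  rw [elemEnd_apply, coord_basisVec_self, ZMod.val_one, one_smul]

/-! ### The Jacobson radical -/

/-- The orders that describe the Jacobson radical: the entries within a homocyclic summand vanish
modulo `p`, and there is no condition on the other entries. -/
def radWeight (n : Fin (m + 1) → ℕ) (i j : Fin (m + 1)) : ℕ :=
  if i = j then n i - 1 else min (n i) (n j)

theorem mul_mem_radWeight (hn : StrictMono n) (hpos : ∀ i, 0 < n i) (f : AddMonoid.End G)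
    {g : AddMonoid.End G} (hg : g ∈ orderBound e (radWeight n)) :
    f * g ∈ orderBound e (radWeight n) := by
  refine mul_mem_orderBound e (mem_orderBound_min e f) hg fun i k j => ?_
  have h1 := hpos i
  have h2 := hpos j
  have h3 := hpos k
  have h : ∀ a b : Fin (m + 1), a ≠ b → n a ≠ n b := fun a b hab h => hab (hn.injective h)
  simp only [radWeight]
  split_ifs with h4 h5 h5
  · subst h4; subst h5; omega
  · subst h4; have := h _ _ h5; omega
  · subst h5; have := h _ _ h4; omega
  · omega

/-- A path of basis elements picks up in each step `i → j` a factor of valuation at least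
`(n j - n i + 1) / 2` in the entry of a power of `f`; the sum telescopes. -/
theorem pow_mem_orderBound (hn : StrictMono n) (hpos : ∀ i, 0 < n i) {f : AddMonoid.End G}
    (hf : f ∈ orderBound e (radWeight n)) (k : ℕ) :
    f ^ k ∈ orderBound e (fun i j => (n i + n j - k) / 2) := by
  induction k with
  | zero =>
    rw [pow_zero]
    exact orderBound_mono e (fun i j => by omega) (mem_orderBound_min e 1)
  | succ k ih =>
    rw [pow_succ]
    refine mul_mem_orderBound e ih hf fun i k' j => ?_
    have := hpos i
    have := hpos k'
    have h1 : radWeight n i k' ≤ (n i + n k' - 1) / 2 := by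
      simp only [radWeight]
      split_ifs with h
      · subst h; omega
      · have : n i ≠ n k' := fun h' => h (hn.injective h')
        omega
    omega

theorem isNilpotent_of_mem_radWeight (hn : StrictMono n) (hpos : ∀ i, 0 < n i)
    {f : AddMonoid.End G} (hf : f ∈ orderBound e (radWeight n)) : IsNilpotent f := by
  refine ⟨2 * n (Fin.last m), eq_zero_of_mem_orderBound_zero e
    (orderBound_mono e (fun i j => ?_) (pow_mem_orderBound e hn hpos hf _))⟩
  have h1 := hn.monotone (Fin.le_last i)
  have h2 := hn.monotone (Fin.le_last j)
  omega

/-- The Jacobson radical consists of the endomorphisms whose entries within each homocyclic summand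
vanish modulo `p`: these form a nil left ideal, and an entry prime to `p` gives a left multiple `y`
of the endomorphism such that `1 - y` kills a basis element. -/
theorem mem_jacobson_iff_orderBound (hn : StrictMono n) (hpos : ∀ i, 0 < n i)
    {f : AddMonoid.End G} :
    f ∈ Ring.jacobson (AddMonoid.End G) ↔ f ∈ orderBound e (radWeight n) := by
  rw [← Ideal.jacobson_bot, Ideal.mem_jacobson_iff]
  constructor
  · intro h
    rw [mem_orderBound_iff_dvd]
    intro u v
    by_cases huv : u.1 = v.1
    · by_contra hcon
      rw [radWeight, if_pos huv] at hcon
      have hp1 : ¬ (p : ℤ) ∣ entry e f u v := fun hdvd => hcon <| by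
        rw [huv]
        conv_lhs => rw [← Nat.sub_add_cancel (hpos v.1), pow_succ]
        exact mul_dvd_mul_left _ hdvd
      obtain ⟨a, b, hab⟩ : IsCoprime (entry e f u v) ((p : ℤ) ^ n u.1) :=
        (IsCoprime.pow_left ((Nat.prime_iff_prime_int.1 hp.out).coprime_iff_not_dvd.2 hp1)).symm
      obtain ⟨z, hz⟩ := h (-(a • elemEnd e v u))
      have h1 : elemEnd e v u (f (basisVec e u)) = entry e f u v • basisVec e u := by
        rw [elemEnd_apply, huv, Nat.sub_self, pow_zero, one_smul, entry, natCast_zsmul]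
      have h2 : a • elemEnd e v u (f (basisVec e u)) = basisVec e u := by
        have h3 : ((p : ℤ) ^ n u.1) • basisVec e u = 0 := by
          have := pow_smul_basisVec e u
          rw [← natCast_zsmul] at this
          exact_mod_cast this
        rw [h1, ← mul_smul, eq_sub_of_add_eq hab, sub_smul, mul_smul, h3, smul_zero, sub_zero,
          one_smul]
      have h4 : z * -(a • elemEnd e v u) * f + z - 1 = 0 := hz
      have h5 : z (-(a • elemEnd e v u (f (basisVec e u)))) + z (basisVec e u) - basisVec e u = 0 :=
        DFunLike.congr_fun h4 (basisVec e u)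
      rw [h2, map_neg, neg_add_cancel, zero_sub, neg_eq_zero] at h5
      have h6 := coord_basisVec_self e u
      have : Fact (1 < p ^ n u.1) := ⟨Nat.one_lt_pow (hpos _).ne' hp.out.one_lt⟩
      rw [h5, map_zero] at h6
      exact zero_ne_one h6
    · rw [radWeight, if_neg huv]
      exact (mem_orderBound_iff_dvd e).1 (mem_orderBound_min e f) u v
  · intro hf y
    obtain ⟨z, hz⟩ := (isNilpotent_of_mem_radWeight e hn hpos
      (mul_mem_radWeight e hn hpos y hf)).isUnit_add_one
    refine ⟨((z⁻¹ : (AddMonoid.End G)ˣ) : AddMonoid.End G), ?_⟩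
    have h1 : ((z⁻¹ : (AddMonoid.End G)ˣ) : AddMonoid.End G) * y * f +
        (z⁻¹ : (AddMonoid.End G)ˣ) - 1
        = (z⁻¹ : (AddMonoid.End G)ˣ) * (y * f + 1) - 1 := by noncomm_ring
    rw [h1, ← hz, Units.inv_mul, sub_self]
    exact zero_mem _

/-! ### Products with elementary endomorphisms -/

open Classical in
theorem coord_mul_elemEnd (hpos : ∀ i, 0 < n i) (f : AddMonoid.End G) (k : ℕ) (u v w z : Σ i, κ i) :
    coord e z ((f * (k • elemEnd e u v)) (basisVec e w)) =
      ((if w = u then k * (p ^ (n v.1 - n u.1) * entry e f v z) else 0 : ℤ) :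
        ZMod (p ^ n z.1)) := by
  change coord e z (f (k • elemEnd e u v (basisVec e w))) = _
  split_ifs with h
  · subst h
    rw [elemEnd_basisVec_self e w v (hpos _), ← mul_smul, map_nsmul, map_nsmul]
    push_cast
    rw [intCast_entry, nsmul_eq_mul]
    push_cast
    ring
  · rw [elemEnd_basisVec_of_ne e h, smul_zero, map_zero, map_zero, Int.cast_zero]

open Classical in
theorem coord_elemEnd_mul (f : AddMonoid.End G) (k : ℕ) (u v w z : Σ i, κ i) :
    coord e z (((k • elemEnd e u v) * f) (basisVec e w)) =
      ((if z = v then k * (p ^ (n v.1 - n u.1) * entry e f w u) else 0 : ℤ) :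
        ZMod (p ^ n z.1)) := by
  change coord e z (k • elemEnd e u v (f (basisVec e w))) = _
  rw [map_nsmul]
  split_ifs with h
  · subst h
    rw [coord_elemEnd_self, nsmul_eq_mul]
    push_cast
    ring
  · rw [coord_elemEnd_of_ne e h, smul_zero, Int.cast_zero]

/-- An elementary endomorphism lies in the radical if it connects different summands; within a
summand its multiples by `p` do. -/
theorem smul_elemEnd_mem_radWeight (hpos : ∀ i, 0 < n i) {k : ℕ} {u v : Σ i, κ i}
    (h : u.1 ≠ v.1 ∨ p ∣ k) : k • elemEnd e u v ∈ orderBound e (radWeight n) := by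
  intro w z
  by_cases hwz : w.1 = z.1
  · rw [radWeight, if_pos hwz]
    have h1 := coord_mul_elemEnd e hpos 1 k u v w z
    have h2 := coord_elemEnd_mul e 1 k u v w z
    rw [one_mul] at h1
    rw [mul_one] at h2
    by_cases hwu : w = u
    · by_cases hzv : z = v
      · subst hwu; subst hzv
        obtain ⟨k', rfl⟩ := h.resolve_left (not_not.2 hwz)
        refine (ZMod.pow_smul_eq_zero_iff h1.symm _).2 ?_
        rw [if_pos rfl, hwz, Nat.cast_mul, mul_assoc (p : ℤ)]
        conv_lhs => rw [← Nat.sub_add_cancel (hpos z.1), pow_succ]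
        exact mul_dvd_mul_left _ (Dvd.intro _ rfl)
      · rw [h2, if_neg hzv, Int.cast_zero, smul_zero]
    · rw [h1, if_neg hwu, Int.cast_zero, smul_zero]
  · rw [radWeight, if_neg hwz]
    exact mem_orderBound_min e _ w z

/-! ### The annihilating series -/

theorem mul_mem_upperFun_right (hn : StrictMono n) {t : ℕ} {f : AddMonoid.End G}
    (g : AddMonoid.End G) (hf : f ∈ orderBound e (upperFun n t)) :
    f * g ∈ orderBound e (upperFun n t) := by
  refine mul_mem_orderBound e hf (mem_orderBound_min e g) fun i k j => ?_
  have h := upperFun_le_add_sub hn t k i j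
  omega

theorem radical_mul_mem_upperFun (hn : StrictMono n) {t : ℕ} {f g : AddMonoid.End G}
    (hf : f ∈ orderBound e (radWeight n)) (hg : g ∈ orderBound e (upperFun n (t + 1))) :
    f * g ∈ orderBound e (upperFun n t) := by
  refine mul_mem_orderBound e hf hg fun i k j => ?_
  rw [radWeight]
  split_ifs with h
  · subst h
    have := upperFun_succ_le_add_one (n := n) t i k
    omega
  · have h1 := upperFun_succ_le_of_ne hn t i (Ne.symm h)
    rw [upperFun_comm, upperFun_comm t j] at h1
    omega

theorem mul_radical_mem_upperFun (hn : StrictMono n) (hpos : ∀ i, 0 < n i) {t : ℕ}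
    {f g : AddMonoid.End G} (hf : f ∈ orderBound e (upperFun n (t + 1)))
    (hg : g ∈ orderBound e (radWeight n)) : f * g ∈ orderBound e (upperFun n t) := by
  refine mul_mem_orderBound e hf hg fun i k j => ?_
  rw [radWeight]
  split_ifs with h
  · subst h
    have h1 := upperFun_succ_le_add_one (n := n) t i j
    have h2 := hpos i
    omega
  · have h1 := upperFun_succ_le_of_ne hn t j h
    omega

/-- Testing on elementary endomorphisms bounds the entries of an element of the next term of the
annihilating series; the recursion of the upper function collects these bounds. -/
theorem mem_upperFun_succ_of_mul_mem (hn : StrictMono n) (hpos : ∀ i, 0 < n i)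
    (hκ : ∀ i, Nonempty (κ i)) {t : ℕ} {f : AddMonoid.End G}
    (h : ∀ b ∈ orderBound e (radWeight n),
      f * b ∈ orderBound e (upperFun n t) ∧ b * f ∈ orderBound e (upperFun n t)) :
    f ∈ orderBound e (upperFun n (t + 1)) := by
  classical
  rw [mem_orderBound_iff_dvd]
  intro u v
  have key : ∀ (z : Σ i, κ i) (k : ℕ), z.1 ≠ u.1 ∨ p ∣ k → (p : ℤ) ^ n v.1 ∣
      (p : ℤ) ^ upperFun n t z.1 v.1 * (k * (p ^ (n u.1 - n z.1) * entry e f u v)) := by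
    intro z k hz
    have h1 := (h _ (smul_elemEnd_mem_radWeight e hpos hz)).1 z v
    have h2 := coord_mul_elemEnd e hpos f k z u z v
    rw [if_pos rfl] at h2
    exact (ZMod.pow_smul_eq_zero_iff h2.symm _).1 h1
  rcases upperFun_succ_eq_or hn t u.1 v.1 with h0 | ⟨i, hi, h0⟩ | ⟨j, hj, h0⟩
  · have h1 := key u p (Or.inr dvd_rfl)
    rw [h0, pow_succ, mul_assoc]
    simpa using h1
  · obtain ⟨l⟩ := hκ i
    have h1 := key ⟨i, l⟩ 1 (Or.inl (Fin.ne_of_val_ne (by dsimp only; omega)))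
    rw [Nat.cast_one, one_mul, ← mul_assoc, ← pow_add] at h1
    exact pow_dvd_pow_mul_of_le hp.out h1 (by dsimp only; omega)
  · obtain ⟨l⟩ := hκ j
    have h1 := (h _ (smul_elemEnd_mem_radWeight e hpos (k := 1) (u := v) (v := ⟨j, l⟩)
      (Or.inl (Fin.ne_of_val_ne (by dsimp only; omega))))).2 u ⟨j, l⟩
    have h2 := coord_elemEnd_mul e f 1 v ⟨j, l⟩ u ⟨j, l⟩
    rw [if_pos rfl] at h2
    have h3 := (ZMod.pow_smul_eq_zero_iff h2.symm _).1 h1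
    rw [Nat.cast_one, one_mul, ← mul_assoc, ← pow_add] at h3
    exact pow_dvd_pow_mul_of_le hp.out h3 (by dsimp only; omega)

/-- The upper annihilating series of the Jacobson radical, in terms of the orders of matrix
entries. -/
theorem mem_upperAnnSeries_iff (hn : StrictMono n) (hpos : ∀ i, 0 < n i)
    (hκ : ∀ i, Nonempty (κ i)) (t : ℕ) {f : AddMonoid.End G} :
    f ∈ upperAnnSeries (Ring.jacobson (AddMonoid.End G)) t ↔
      f ∈ orderBound e (radWeight n) ∧ f ∈ orderBound e (upperFun n t) := by
  induction t generalizing f with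
  | zero =>
    change f = 0 ↔ _
    constructor
    · rintro rfl
      exact ⟨zero_mem _, zero_mem _⟩
    · exact fun h => eq_zero_of_mem_orderBound_zero e h.2
  | succ t ih =>
    change (f ∈ Ring.jacobson (AddMonoid.End G) ∧ ∀ b ∈ Ring.jacobson (AddMonoid.End G),
      f * b ∈ upperAnnSeries (Ring.jacobson (AddMonoid.End G)) t ∧
      b * f ∈ upperAnnSeries (Ring.jacobson (AddMonoid.End G)) t) ↔ _
    simp only [mem_jacobson_iff_orderBound e hn hpos, ih]
    constructor
    · rintro ⟨h1, h2⟩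
      exact ⟨h1, mem_upperFun_succ_of_mul_mem e hn hpos hκ
        fun b hb => ⟨(h2 b hb).1.2, (h2 b hb).2.2⟩⟩
    · rintro ⟨h1, h2⟩
      exact ⟨h1, fun b hb => ⟨⟨mul_mem_radWeight e hn hpos f hb,
        mul_radical_mem_upperFun e hn hpos h2 hb⟩,
        ⟨mul_mem_radWeight e hn hpos b h1, radical_mul_mem_upperFun e hn hb h2⟩⟩⟩

/-! ### Scalars modulo a term of the annihilating series -/

/-- A scalar that satisfies the congruence of the last summand satisfies all others. -/
theorem intCast_mem_upperFun (hn : StrictMono n) {t : ℕ} {μ : ℤ}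
    (h : (p : ℤ) ^ n (Fin.last m) ∣ (p : ℤ) ^ upperFun n t (Fin.last m) (Fin.last m) * μ) :
    (μ : AddMonoid.End G) ∈ orderBound e (upperFun n t) := by
  intro u v
  by_cases huv : u = v
  · subst huv
    refine (ZMod.pow_smul_eq_zero_iff (coord_intCast_self e μ u).symm _).2
      (pow_dvd_pow_mul_of_le hp.out h ?_)
    have h1 := upperFun_diag_le hn t (Fin.le_last u.1)
    have h2 := hn.monotone (Fin.le_last u.1)
    omega
  · rw [coord_intCast_of_ne e μ huv, smul_zero]

theorem dvd_entry_of_mem_radWeight (hpos : ∀ i, 0 < n i) {f : AddMonoid.End G}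
    (hf : f ∈ orderBound e (radWeight n)) {u v : Σ i, κ i} (huv : u.1 = v.1) :
    (p : ℤ) ∣ entry e f u v := by
  have h := (mem_orderBound_iff_dvd e).1 hf u v
  rw [radWeight, if_pos huv, huv] at h
  have := hpos v.1
  simpa using pow_dvd_pow_mul_of_le hp.out (N' := 1) (k' := 0) h (by omega)

/-! ### Commutators with elementary endomorphisms -/

open Classical in
theorem coord_commutator_elemEnd (hpos : ∀ i, 0 < n i) (f : AddMonoid.End G) (k : ℕ)
    (u v w z : Σ i, κ i) :
    coord e z ((f * (k • elemEnd e u v) - (k • elemEnd e u v) * f) (basisVec e w)) =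
      (((if w = u then k * (p ^ (n v.1 - n u.1) * entry e f v z) else 0) -
        (if z = v then k * (p ^ (n v.1 - n u.1) * entry e f w u) else 0) : ℤ) :
        ZMod (p ^ n z.1)) := by
  change coord e z ((f * (k • elemEnd e u v)) (basisVec e w) -
    ((k • elemEnd e u v) * f) (basisVec e w)) = _
  rw [map_sub, coord_mul_elemEnd e hpos, coord_elemEnd_mul]
  push_cast
  rfl

open Classical in
theorem dvd_of_commutator_mem (hpos : ∀ i, 0 < n i) {w₀ : Fin (m + 1) → Fin (m + 1) → ℕ}
    {f : AddMonoid.End G} {k : ℕ} {u v : Σ i, κ i}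
    (h : f * (k • elemEnd e u v) - (k • elemEnd e u v) * f ∈ orderBound e w₀) (w z : Σ i, κ i) :
    (p : ℤ) ^ n z.1 ∣ (p : ℤ) ^ w₀ w.1 z.1 *
      ((if w = u then k * (p ^ (n v.1 - n u.1) * entry e f v z) else 0) -
        (if z = v then k * (p ^ (n v.1 - n u.1) * entry e f w u) else 0)) :=
  (ZMod.pow_smul_eq_zero_iff (coord_commutator_elemEnd e hpos f k u v w z).symm _).1 (h w z)

/-- If the commutators of `a` with the elementary endomorphisms in the radical lie in a term of the
annihilating series, then `a` is congruent to a scalar modulo the next term. -/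
theorem sub_entry_mem_upperFun_succ (hn : StrictMono n) (hpos : ∀ i, 0 < n i)
    (hκ : ∀ i, Nonempty (κ i)) {t : ℕ} {a : AddMonoid.End G}
    (h : ∀ (u v : Σ i, κ i) (k : ℕ), u.1 ≠ v.1 ∧ k = 1 ∨ u.1 = v.1 ∧ k = p →
      a * (k • elemEnd e u v) - (k • elemEnd e u v) * a ∈ orderBound e (upperFun n t))
    {r : Σ i, κ i} (hr : r.1 = Fin.last m) :
    a - ((entry e a r r : ℤ) : AddMonoid.End G) ∈ orderBound e (upperFun n (t + 1)) := by
  classical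
  have offdiag : ∀ u v : Σ i, κ i, u ≠ v →
      (p : ℤ) ^ n v.1 ∣ (p : ℤ) ^ upperFun n (t + 1) u.1 v.1 * entry e a u v := by
    intro u v huv
    rcases upperFun_succ_eq_or hn t u.1 v.1 with h0 | ⟨i, hi, h0⟩ | ⟨j, hj, h0⟩
    · have h1 := dvd_of_commutator_mem e hpos (h v v p (Or.inr ⟨rfl, rfl⟩)) u v
      rw [if_neg huv, if_pos rfl, Nat.sub_self, pow_zero, one_mul, zero_sub, mul_neg, dvd_neg] at h1
      rw [h0, pow_succ, mul_assoc]
      exact h1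
    · obtain ⟨l⟩ := hκ i
      have h1 := dvd_of_commutator_mem e hpos (h ⟨i, l⟩ u 1
        (Or.inl ⟨Fin.ne_of_val_ne (by dsimp only; omega), rfl⟩)) ⟨i, l⟩ v
      rw [if_pos rfl, if_neg huv.symm, sub_zero, Nat.cast_one, one_mul, ← mul_assoc,
        ← pow_add] at h1
      exact pow_dvd_pow_mul_of_le hp.out h1 (by dsimp only; omega)
    · obtain ⟨l⟩ := hκ j
      have h1 := dvd_of_commutator_mem e hpos (h v ⟨j, l⟩ 1
        (Or.inl ⟨Fin.ne_of_val_ne (by dsimp only; omega), rfl⟩)) u ⟨j, l⟩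
      rw [if_pos rfl, if_neg huv, zero_sub, mul_neg, dvd_neg, Nat.cast_one, one_mul, ← mul_assoc,
        ← pow_add] at h1
      exact pow_dvd_pow_mul_of_le hp.out h1 (by dsimp only; omega)
  have entry_sub : ∀ (u v : Σ i, κ i) (k : ℕ), u ≠ v → u.1 ≠ v.1 ∧ k = 1 ∨ u.1 = v.1 ∧ k = p →
      (p : ℤ) ^ n v.1 ∣ (p : ℤ) ^ upperFun n t u.1 v.1 *
        (k * (p ^ (n v.1 - n u.1) * (entry e a v v - entry e a u u))) := by
    intro u v k huv hk
    have h1 := dvd_of_commutator_mem e hpos (h u v k hk) u v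
    rwa [if_pos rfl, if_pos rfl, ← mul_sub, ← mul_sub] at h1
  -- the diagonal entries are compared with the one at `r`: directly in the last summand, and
  -- through the next summand in the others
  have diag : ∀ (d : ℕ) (v : Σ i, κ i), (v.1 : ℕ) + d = m →
      (p : ℤ) ^ n v.1 ∣ (p : ℤ) ^ upperFun n (t + 1) v.1 v.1 *
        (entry e a v v - entry e a r r) := by
    intro d
    induction d with
    | zero =>
      intro v hv
      have hvr : v.1 = r.1 := by rw [hr]; ext; simpa using hv
      by_cases hne : r = v
      · rw [hne, sub_self, mul_zero]
        exact dvd_zero _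
      have two_step : ∀ i : Fin (m + 1), i ≠ v.1 →
          upperFun n (t + 1) v.1 v.1 = n v.1 - n i + upperFun n t i v.1 →
          (p : ℤ) ^ n v.1 ∣ (p : ℤ) ^ upperFun n (t + 1) v.1 v.1 *
            (entry e a v v - entry e a r r) := by
        intro i hi h0
        obtain ⟨l⟩ := hκ i
        have h1 := entry_sub ⟨i, l⟩ v 1 (fun h => hi (congrArg Sigma.fst h)) (Or.inl ⟨hi, rfl⟩)
        have h2 := entry_sub ⟨i, l⟩ r 1 (fun h => hi ((congrArg Sigma.fst h).trans hvr.symm))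
          (Or.inl ⟨hvr ▸ hi, rfl⟩)
        rw [← hvr] at h2
        have h3 := dvd_sub h1 h2
        rw [← mul_sub, ← mul_sub, ← mul_sub, sub_sub_sub_cancel_right, Nat.cast_one, one_mul,
          ← mul_assoc, ← pow_add] at h3
        exact pow_dvd_pow_mul_of_le hp.out h3 (by dsimp only; omega)
      rcases upperFun_succ_eq_or hn t v.1 v.1 with h0 | ⟨i, hi, h0⟩ | ⟨i, hi, h0⟩
      · have h1 := entry_sub r v p hne (Or.inr ⟨hvr.symm, rfl⟩)
        rw [← hvr, Nat.sub_self, pow_zero, one_mul] at h1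
        rw [h0, pow_succ, mul_assoc]
        exact h1
      · exact two_step i (Fin.ne_of_val_ne (by omega)) h0
      · rw [upperFun_comm t] at h0
        exact two_step i (Fin.ne_of_val_ne (by omega)) h0
    | succ d ih =>
      intro v hv
      let i : Fin (m + 1) := ⟨v.1 + 1, by omega⟩
      obtain ⟨l⟩ := hκ i
      have hi : (i : ℕ) = v.1 + 1 := rfl
      have hiv : i ≠ v.1 := Fin.ne_of_val_ne (by omega)
      have hle : v.1 ≤ i := by rw [Fin.le_def]; omega
      have h1 := entry_sub ⟨i, l⟩ v 1 (fun h => hiv (congrArg Sigma.fst h)) (Or.inl ⟨hiv, rfl⟩)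
      have h2 := ih ⟨i, l⟩ (by dsimp only; omega)
      have h3 := upperFun_diag_le hn (t + 1) hle
      have h4 := hn.monotone hle
      rw [Nat.cast_one, one_mul, Nat.sub_eq_zero_of_le h4, pow_zero, one_mul,
        ← upperFun_succ_diag hn t hi] at h1
      have h5 := pow_dvd_pow_mul_of_le hp.out (N' := n v.1) (k' := upperFun n (t + 1) v.1 v.1) h2
        (by dsimp only; omega)
      have h6 := dvd_add h1 h5
      rwa [← mul_add, sub_add_sub_cancel] at h6
  intro u v
  change _ • coord e v (a (basisVec e u) -
    ((entry e a r r : ℤ) : AddMonoid.End G) (basisVec e u)) = 0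
  rw [map_sub]
  by_cases huv : u = v
  · subst huv
    have hc : ((entry e a u u - entry e a r r : ℤ) : ZMod (p ^ n u.1)) =
        coord e u (a (basisVec e u)) -
          coord e u (((entry e a r r : ℤ) : AddMonoid.End G) (basisVec e u)) := by
      rw [Int.cast_sub, intCast_entry, coord_intCast_self]
    exact (ZMod.pow_smul_eq_zero_iff hc _).2 (diag (m - u.1) u (by have := u.1.isLt; omega))
  · rw [coord_intCast_of_ne e _ huv, sub_zero]
    exact (ZMod.pow_smul_eq_zero_iff (intCast_entry e a u v) _).2 (offdiag u v huv)

/-! ### Removing the scalar from a group commutator -/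

/-- If `c` is congruent to `μ * (1 + b) * (1 + a)` with `a` and `b` in the radical, then its
diagonal entries are congruent to `μ` times units, since those of `(1 + b) * (1 + a)`
are `1` modulo `p`. -/
theorem exists_dvd_diag_sub (hn : StrictMono n) (hpos : ∀ i, 0 < n i) {t : ℕ}
    {a b c : AddMonoid.End G} {μ : ℤ} (ha : a ∈ orderBound e (radWeight n))
    (hb : b ∈ orderBound e (radWeight n))
    (h : c - (μ : AddMonoid.End G) * ((1 + b) * (1 + a)) ∈ orderBound e (upperFun n t))
    (v : Σ i, κ i) {z : ℤ} (hz : (z : ZMod (p ^ n v.1)) = coord e v (c (basisVec e v))) :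
    ∃ y : ℤ, (p : ℤ) ^ n v.1 ∣ (p : ℤ) ^ upperFun n t v.1 v.1 * (z - μ * (1 + p * y)) := by
  have hj : b + a + b * a ∈ orderBound e (radWeight n) :=
    add_mem (add_mem hb ha) (mul_mem_radWeight e hn hpos b ha)
  obtain ⟨y, hy⟩ := dvd_entry_of_mem_radWeight e hpos hj (rfl : v.1 = v.1)
  refine ⟨y, (ZMod.pow_smul_eq_zero_iff ?_ _).1 (h v v)⟩
  have h1 : (1 + b) * (1 + a) = 1 + (b + a + b * a) := by noncomm_ring
  rw [h1, ← hy]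
  change _ = coord e v (c (basisVec e v) - (μ : AddMonoid.End G)
    (basisVec e v + (b + a + b * a) (basisVec e v)))
  rw [map_sub, AddMonoid.End.intCast_apply, map_zsmul, map_add, coord_basisVec_self, ← hz,
    ← intCast_entry]
  push_cast
  rw [zsmul_eq_mul]

theorem mem_of_sub_intCast_mul_mem (hn : StrictMono n) {t : ℕ} {c y : AddMonoid.End G} {μ : ℤ}
    (h : c - (μ : AddMonoid.End G) * y ∈ orderBound e (upperFun n t))
    (hμ : (p : ℤ) ^ n (Fin.last m) ∣ (p : ℤ) ^ upperFun n t (Fin.last m) (Fin.last m) * μ) :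
    c ∈ orderBound e (upperFun n t) := by
  have h1 := add_mem h (mul_mem_upperFun_right e hn y (intCast_mem_upperFun e hn hμ))
  rwa [sub_add_cancel] at h1

/-- If the entry of `c` at some diagonal position of the last summand satisfies the congruence
there, then so does the scalar `μ`, hence `c` satisfies all congruences. -/
theorem mem_of_diag_entry (hn : StrictMono n) (hpos : ∀ i, 0 < n i) {t : ℕ}
    {a b c : AddMonoid.End G} {μ : ℤ} (ha : a ∈ orderBound e (radWeight n))
    (hb : b ∈ orderBound e (radWeight n))
    (h : c - (μ : AddMonoid.End G) * ((1 + b) * (1 + a)) ∈ orderBound e (upperFun n t))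
    {r : Σ i, κ i} (hr : r.1 = Fin.last m) {z : ℤ}
    (hz : (z : ZMod (p ^ n r.1)) = coord e r (c (basisVec e r)))
    (hdvd : (p : ℤ) ^ n r.1 ∣ (p : ℤ) ^ upperFun n t r.1 r.1 * z) :
    c ∈ orderBound e (upperFun n t) := by
  obtain ⟨y, hy⟩ := exists_dvd_diag_sub e hn hpos ha hb h r hz
  have h1 := dvd_sub hdvd hy
  rw [← mul_sub, sub_sub_cancel, ← mul_assoc] at h1
  have hp1 : ¬ (p : ℤ) ∣ 1 + p * y := fun hd =>
    (Nat.prime_iff_prime_int.1 hp.out).not_dvd_one ((dvd_add_left (Dvd.intro _ rfl)).1 hd)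
  have h2 := pow_dvd_of_pow_dvd_mul_of_not_dvd hp.out h1 hp1
  rw [hr] at h2
  exact mem_of_sub_intCast_mul_mem e hn h h2

/-- If `p` is odd, two opposite diagonal entries also determine the scalar, when both satisfy
congruences at least as strong as the one in the last summand. -/
theorem mem_of_opposite_diag_entries (hn : StrictMono n) (hpos : ∀ i, 0 < n i) (h3 : 3 ≤ p) {t : ℕ}
    {a b c : AddMonoid.End G} {μ : ℤ} (ha : a ∈ orderBound e (radWeight n))
    (hb : b ∈ orderBound e (radWeight n))
    (h : c - (μ : AddMonoid.End G) * ((1 + b) * (1 + a)) ∈ orderBound e (upperFun n t))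
    {u v : Σ i, κ i} {z : ℤ}
    (hzu : (z : ZMod (p ^ n u.1)) = coord e u (c (basisVec e u)))
    (hzv : ((-z : ℤ) : ZMod (p ^ n v.1)) = coord e v (c (basisVec e v)))
    (hu : n (Fin.last m) + upperFun n t u.1 u.1 ≤
      n u.1 + upperFun n t (Fin.last m) (Fin.last m))
    (hv : n (Fin.last m) + upperFun n t v.1 v.1 ≤
      n v.1 + upperFun n t (Fin.last m) (Fin.last m)) :
    c ∈ orderBound e (upperFun n t) := by
  obtain ⟨y, hy⟩ := exists_dvd_diag_sub e hn hpos ha hb h u hzu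
  obtain ⟨y', hy'⟩ := exists_dvd_diag_sub e hn hpos ha hb h v hzv
  have h1 := dvd_add (pow_dvd_pow_mul_of_le hp.out hy hu) (pow_dvd_pow_mul_of_le hp.out hy' hv)
  have h2 : (p : ℤ) ^ upperFun n t (Fin.last m) (Fin.last m) * (z - μ * (1 + p * y)) +
      (p : ℤ) ^ upperFun n t (Fin.last m) (Fin.last m) * (-z - μ * (1 + p * y')) =
      ((p : ℤ) ^ upperFun n t (Fin.last m) (Fin.last m) * μ) * -(2 + p * (y + y')) := by ring
  rw [h2] at h1
  have hp1 : ¬ (p : ℤ) ∣ -(2 + p * (y + y')) := by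
    rw [dvd_neg, dvd_add_left (Dvd.intro _ rfl)]
    intro hd
    have := Int.le_of_dvd (by norm_num) hd
    omega
  exact mem_of_sub_intCast_mul_mem e hn h (pow_dvd_of_pow_dvd_mul_of_not_dvd hp.out h1 hp1)

/-- The prime `p` is odd, or all gaps of the sequence `n` are at least `2`, or the last homocyclic
summand is not cyclic. For a sequence with one term the second condition holds vacuously. -/
def CentralCase (p : ℕ) (n : Fin (m + 1) → ℕ) (κ : Fin (m + 1) → Type u) : Prop :=
  3 ≤ p ∨ (∀ i j : Fin (m + 1), (j : ℕ) = i + 1 → n i + 2 ≤ n j) ∨ Nontrivial (κ (Fin.last m))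

/-- If `1 + a` commutes with `1 + 𝒥` up to elements of `1 + 𝒥` that are congruent to scalars modulo
a term of the annihilating series, then the ring commutators of `a` with the elementary
endomorphisms in `𝒥` lie in that term. -/
theorem commutator_elemEnd_mem (hn : StrictMono n) (hpos : ∀ i, 0 < n i)
    (hκ : ∀ i, Nonempty (κ i)) (hcase : CentralCase p n κ) {t : ℕ} (ht : 1 ≤ t)
    {a : AddMonoid.End G} (ha : a ∈ orderBound e (radWeight n))
    (h : ∀ b ∈ orderBound e (radWeight n), ∃ μ : ℤ,
      a * b - b * a - (μ : AddMonoid.End G) * ((1 + b) * (1 + a)) ∈ orderBound e (upperFun n t))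
    (u v : Σ i, κ i) (k : ℕ) (hk : u.1 ≠ v.1 ∧ k = 1 ∨ u.1 = v.1 ∧ k = p) :
    a * (k • elemEnd e u v) - (k • elemEnd e u v) * a ∈ orderBound e (upperFun n t) := by
  classical
  have rad : ∀ {u v : Σ i, κ i} {k : ℕ}, u.1 ≠ v.1 ∧ k = 1 ∨ u.1 = v.1 ∧ k = p →
      k • elemEnd e u v ∈ orderBound e (radWeight n) := fun hk =>
    smul_elemEnd_mem_radWeight e hpos (hk.imp And.left fun h' => dvd_of_eq h'.2.symm)
  have coord_comm := fun k u v w => (coord_commutator_elemEnd e hpos a k u v w w).symm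
  -- away from `u` and `v` the diagonal entries of the commutator vanish
  have away : ∀ {u v : Σ i, κ i} {k : ℕ}, u.1 ≠ v.1 ∧ k = 1 ∨ u.1 = v.1 ∧ k = p →
      ∀ r : Σ i, κ i, r.1 = Fin.last m → r ≠ u → r ≠ v →
      a * (k • elemEnd e u v) - (k • elemEnd e u v) * a ∈ orderBound e (upperFun n t) := by
    intro u v k hk r hr hru hrv
    obtain ⟨μ, hμ⟩ := h _ (rad hk)
    refine mem_of_diag_entry e hn hpos ha (rad hk) hμ hr (coord_comm _ _ _ _) ?_
    rw [if_neg hru, if_neg hrv, sub_zero, mul_zero]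
    exact dvd_zero _
  obtain ⟨r₀⟩ := hκ (Fin.last m)
  have same : ∀ u : Σ i, κ i,
      a * (p • elemEnd e u u) - (p • elemEnd e u u) * a ∈ orderBound e (upperFun n t) := by
    intro u
    have hk : u.1 ≠ u.1 ∧ p = 1 ∨ u.1 = u.1 ∧ p = p := Or.inr ⟨rfl, rfl⟩
    by_cases hu : u.1 = Fin.last m
    · obtain ⟨μ, hμ⟩ := h _ (rad hk)
      refine mem_of_diag_entry e hn hpos ha (rad hk) hμ hu (coord_comm _ _ _ _) ?_
      rw [if_pos rfl, sub_self, mul_zero]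
      exact dvd_zero _
    · have hne : (⟨Fin.last m, r₀⟩ : Σ i, κ i) ≠ u := fun h => hu (h ▸ rfl)
      exact away hk _ rfl hne hne
  -- the commutator with `p` times the projection to a basis element
  have offdiag : ∀ w v : Σ i, κ i, w ≠ v →
      (p : ℤ) ^ n v.1 ∣ (p : ℤ) ^ (upperFun n t w.1 v.1 + 1) * entry e a w v := by
    intro w v hwv
    have h1 := dvd_of_commutator_mem e hpos (same v) w v
    rw [if_neg hwv, if_pos rfl, Nat.sub_self, pow_zero, one_mul, zero_sub, mul_neg, dvd_neg] at h1
    rw [pow_succ, mul_assoc]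
    exact h1
  rcases hk with ⟨huv, rfl⟩ | ⟨huv, hkp⟩
  · have hne : u ≠ v := fun h => huv (congrArg Sigma.fst h)
    have hk : u.1 ≠ v.1 ∧ 1 = 1 ∨ u.1 = v.1 ∧ 1 = p := Or.inl ⟨huv, rfl⟩
    by_cases hlast : u.1 ≠ Fin.last m ∧ v.1 ≠ Fin.last m
    · exact away hk ⟨Fin.last m, r₀⟩ rfl (fun h => hlast.1 (h ▸ rfl)) fun h => hlast.2 (h ▸ rfl)
    obtain ⟨μ, hμ⟩ := h _ (rad hk)
    have hzu := coord_comm 1 u v u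
    have hzv := coord_comm 1 u v v
    rw [if_pos rfl, if_neg hne, sub_zero, Nat.cast_one, one_mul] at hzu
    rw [if_neg hne.symm, if_pos rfl, zero_sub, Nat.cast_one, one_mul] at hzv
    -- a strict increase of the upper function towards the last summand
    have strict : upperFun n t v.1 u.1 + 1 ≤ upperFun n t (Fin.last m) (Fin.last m) →
        a * (1 • elemEnd e u v) - (1 • elemEnd e u v) * a ∈ orderBound e (upperFun n t) := by
      intro hlt
      have h1 := offdiag v u hne.symm
      have hul := hn.monotone (Fin.le_last u.1)
      have hvl := hn.monotone (Fin.le_last v.1)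
      by_cases hu : u.1 = Fin.last m
      · refine mem_of_diag_entry e hn hpos ha (rad hk) hμ hu hzu ?_
        rw [← mul_assoc, ← pow_add]
        refine pow_dvd_pow_mul_of_le hp.out h1 ?_
        rw [← hu] at hlt
        omega
      · have hv : v.1 = Fin.last m := by
          by_contra hv
          exact hlast ⟨hu, hv⟩
        refine mem_of_diag_entry e hn hpos ha (rad hk) hμ hv hzv ?_
        rw [mul_neg, dvd_neg, ← mul_assoc, ← pow_add]
        refine pow_dvd_pow_mul_of_le hp.out h1 ?_
        rw [← hv] at hlt hul
        omega
    by_cases hκ' : Nontrivial (κ (Fin.last m))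
    · by_cases hu : u.1 = Fin.last m
      · obtain ⟨i, l⟩ := u
        dsimp only at hu
        subst hu
        obtain ⟨r', hr'⟩ := exists_ne l
        refine away hk ⟨Fin.last m, r'⟩ rfl ?_ fun h => huv (by rw [← h])
        intro h
        exact hr' (eq_of_heq (Sigma.mk.inj h).2)
      · have hv : v.1 = Fin.last m := by
          by_contra hv
          exact hlast ⟨hu, hv⟩
        obtain ⟨i, l⟩ := v
        dsimp only at hv
        subst hv
        obtain ⟨r', hr'⟩ := exists_ne l
        refine away hk ⟨Fin.last m, r'⟩ rfl (fun h => huv (by rw [← h])) ?_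
        intro h
        exact hr' (eq_of_heq (Sigma.mk.inj h).2)
    have odd_or : ∀ j : Fin (m + 1), j ≠ Fin.last m →
        upperFun n t j (Fin.last m) + 1 ≤ upperFun n t (Fin.last m) (Fin.last m) ∨
        (3 ≤ p ∧ n (Fin.last m) + upperFun n t j j ≤
          n j + upperFun n t (Fin.last m) (Fin.last m)) := by
      intro j hj
      rcases upperFun_last_lt_or hn ht hj with h1 | ⟨h1, h2, h3⟩
      · exact Or.inl h1
      · rcases hcase with hc | hc | hc
        · exact Or.inr ⟨hc, h3⟩
        · have := hc j (Fin.last m) (by rw [Fin.val_last]; omega)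
          omega
        · exact absurd hc hκ'
    by_cases hu : u.1 = Fin.last m
    · rcases odd_or v.1 (fun h => huv (hu.trans h.symm)) with h1 | ⟨h1, h2⟩
      · exact strict (by rwa [hu])
      · exact mem_of_opposite_diag_entries e hn hpos h1 ha (rad hk) hμ hzu hzv (by rw [hu]) h2
    · have hv : v.1 = Fin.last m := by
        by_contra hv
        exact hlast ⟨hu, hv⟩
      rcases odd_or u.1 hu with h1 | ⟨h1, h2⟩
      · exact strict (by rwa [hv, upperFun_comm])
      · exact mem_of_opposite_diag_entries e hn hpos h1 ha (rad hk) hμ hzu hzv h2 (by rw [hv])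
  · rw [hkp]
    by_cases hne : u = v
    · subst hne
      exact same u
    have hk : u.1 ≠ v.1 ∧ p = 1 ∨ u.1 = v.1 ∧ p = p := Or.inr ⟨huv, rfl⟩
    by_cases hu : u.1 = Fin.last m
    · obtain ⟨μ, hμ⟩ := h _ (rad hk)
      have hzu := coord_comm p u v u
      rw [if_pos rfl, if_neg hne, sub_zero] at hzu
      refine mem_of_diag_entry e hn hpos ha (rad hk) hμ hu hzu ?_
      have h1 := offdiag v u (Ne.symm hne)
      rw [huv, Nat.sub_self, pow_zero, one_mul, ← mul_assoc, ← pow_succ]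
      rwa [huv] at h1
    · exact away hk ⟨Fin.last m, r₀⟩ rfl (fun h => hu (h ▸ rfl)) fun h =>
        hu (huv.trans (h ▸ rfl))

/-! ### The upper central series -/

open scoped commutatorElement

theorem mem_radicalGroup_iff (hn : StrictMono n) (hpos : ∀ i, 0 < n i) {x : (AddMonoid.End G)ˣ} :
    x ∈ radicalGroup G ↔ (x : AddMonoid.End G) - 1 ∈ orderBound e (radWeight n) :=
  mem_jacobson_iff_orderBound e hn hpos

/-- Every element of `1 + 𝒥` is a unit. -/
theorem exists_radicalGroup_eq_one_add (hn : StrictMono n) (hpos : ∀ i, 0 < n i)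
    {b : AddMonoid.End G} (hb : b ∈ orderBound e (radWeight n)) :
    ∃ y : radicalGroup G, ((y : (AddMonoid.End G)ˣ) : AddMonoid.End G) = 1 + b := by
  obtain ⟨y, hy⟩ := (isNilpotent_of_mem_radWeight e hn hpos hb).isUnit_one_add
  refine ⟨⟨y, (mem_radicalGroup_iff e hn hpos).2 ?_⟩, hy⟩
  rwa [hy, add_sub_cancel_left]

/-- The equation `⁅x, y⁆ y x = x y`, in the ring. -/
theorem coe_commutator_mul {R : Type v} [Ring R] {S : Subgroup Rˣ} (x y : S) :
    ((⁅x, y⁆ : S) : Rˣ) * ((y : Rˣ) * (x : Rˣ) : R) = ((x : Rˣ) : R) * (y : Rˣ) := by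
  have h : ⁅x, y⁆ * (y * x) = x * y := by rw [commutatorElement_def]; group
  have h1 := congrArg (fun z : S => ((z : Rˣ) : R)) h
  simpa using h1

/-- A commutator with an element of `1 + 𝒥` moves `1 + a`, with `a` in a term of the annihilating
series, to the previous term, because `⁅x, y⁆ - 1 = (x y - y x) (y x)⁻¹`. -/
theorem mem_upperCentralSeries_of_mem_upperFun (hn : StrictMono n) (hpos : ∀ i, 0 < n i) (t : ℕ)
    (x : radicalGroup G)
    (hx : ((x : (AddMonoid.End G)ˣ) : AddMonoid.End G) - 1 ∈ orderBound e (upperFun n t)) :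
    x ∈ Subgroup.upperCentralSeries (radicalGroup G) t := by
  induction t generalizing x with
  | zero =>
    rw [Subgroup.upperCentralSeries_zero, Subgroup.mem_bot]
    exact Subtype.ext (Units.ext (sub_eq_zero.1 (eq_zero_of_mem_orderBound_zero e hx)))
  | succ t ih =>
    rw [Subgroup.mem_upperCentralSeries_succ_iff]
    intro y
    apply ih
    have h1 := coe_commutator_mul x y
    have hy := (mem_radicalGroup_iff e hn hpos).1 y.2
    generalize ((⁅x, y⁆ : radicalGroup G) : (AddMonoid.End G)ˣ) = c at *
    generalize (y : (AddMonoid.End G)ˣ) = y at *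
    generalize (x : (AddMonoid.End G)ˣ) = x at *
    have h2 : (c : AddMonoid.End G) - 1 = (((x : AddMonoid.End G) - 1) * ((y : AddMonoid.End G) - 1)
        - ((y : AddMonoid.End G) - 1) * ((x : AddMonoid.End G) - 1)) *
          ((y * x)⁻¹ : (AddMonoid.End G)ˣ) := by
      rw [Units.eq_mul_inv_iff_mul_eq, sub_mul, Units.val_mul, h1]
      noncomm_ring
    rw [h2]
    exact mul_mem_upperFun_right e hn _ (sub_mem (mul_radical_mem_upperFun e hn hpos hx hy)
      (radical_mul_mem_upperFun e hn hy hx))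

/-- Elements of the upper central series are congruent to scalars. In the first step the scalar in
the group commutator vanishes, because the commutator is trivial. -/
theorem sub_entry_mem_of_mem_upperCentralSeries (hn : StrictMono n) (hpos : ∀ i, 0 < n i)
    (hκ : ∀ i, Nonempty (κ i)) (hcase : CentralCase p n κ) (t : ℕ) {x : radicalGroup G}
    (hx : x ∈ Subgroup.upperCentralSeries (radicalGroup G) t) {r : Σ i, κ i}
    (hr : r.1 = Fin.last m) :
    ((x : (AddMonoid.End G)ˣ) : AddMonoid.End G) - 1 -
      ((entry e (((x : (AddMonoid.End G)ˣ) : AddMonoid.End G) - 1) r r : ℤ) : AddMonoid.End G) ∈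
        orderBound e (upperFun n t) := by
  induction t generalizing x with
  | zero =>
    rw [Subgroup.upperCentralSeries_zero, Subgroup.mem_bot] at hx
    subst hx
    have h0 : entry e (0 : AddMonoid.End G) r r = 0 := by
      change ((coord e r 0).val : ℤ) = 0
      rw [map_zero, ZMod.val_zero, Nat.cast_zero]
    rw [OneMemClass.coe_one, Units.val_one, sub_self, h0, Int.cast_zero, sub_zero]
    exact zero_mem _
  | succ t ih =>
    refine sub_entry_mem_upperFun_succ e hn hpos hκ ?_ hr
    have ha := (mem_radicalGroup_iff e hn hpos).1 x.2
    rw [Subgroup.mem_upperCentralSeries_succ_iff] at hx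
    -- a group commutator `1 + c` turns into the ring commutator `c (1 + b) (1 + a)`
    have key : ∀ b ∈ orderBound e (radWeight n), ∃ μ : ℤ, (t = 0 → μ = 0) ∧
        (((x : (AddMonoid.End G)ˣ) : AddMonoid.End G) - 1) * b -
          b * (((x : (AddMonoid.End G)ˣ) : AddMonoid.End G) - 1) - (μ : AddMonoid.End G) *
          ((1 + b) * (1 + (((x : (AddMonoid.End G)ˣ) : AddMonoid.End G) - 1))) ∈
            orderBound e (upperFun n t) := by
      intro b hb
      obtain ⟨y, hy⟩ := exists_radicalGroup_eq_one_add e hn hpos hb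
      have h1 := ih (hx y)
      have h2 := coe_commutator_mul x y
      rw [hy] at h2
      refine ⟨entry e (((⁅x, y⁆ : radicalGroup G) : (AddMonoid.End G)ˣ) - 1) r r, ?_, ?_⟩
      rotate_left
      · have h3 := mul_mem_upperFun_right e hn
          ((1 + b) * ((x : (AddMonoid.End G)ˣ) : AddMonoid.End G)) h1
        rw [sub_mul, sub_mul, h2] at h3
        convert h3 using 1
        noncomm_ring
      · intro ht
        have h3 := hx y
        rw [ht, Subgroup.upperCentralSeries_zero, Subgroup.mem_bot] at h3
        rw [h3, OneMemClass.coe_one, Units.val_one, sub_self]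
        change ((coord e r 0).val : ℤ) = 0
        rw [map_zero, ZMod.val_zero, Nat.cast_zero]
    intro u v k hk
    rcases Nat.eq_zero_or_pos t with ht | ht
    · obtain ⟨μ, h1, h2⟩ := key _ (smul_elemEnd_mem_radWeight e hpos
        (hk.imp And.left fun h' => dvd_of_eq h'.2.symm))
      rwa [h1 ht, Int.cast_zero, zero_mul, sub_zero] at h2
    · exact commutator_elemEnd_mem e hn hpos hκ hcase ht ha
        (fun b hb => (key b hb).imp fun _ h => h.2) u v k hk

/-! ### The congruences -/

/-- The congruences say that `x - 1` is congruent to the scalar given by its diagonal entry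
at `r`. -/
theorem mem_congruenceSet_iff (r : κ (Fin.last m)) (t : ℕ)
    {x : (AddMonoid.End G)ˣ} :
    x ∈ congruenceSet e r t ↔ x ∈ radicalGroup G ∧ (x : AddMonoid.End G) - 1 -
      ((entry e ((x : AddMonoid.End G) - 1) ⟨Fin.last m, r⟩ ⟨Fin.last m, r⟩ : ℤ) :
        AddMonoid.End G) ∈ orderBound e (upperFun n t) := by
  have modEq : ∀ (a b N k : ℕ), a ≡ b [MOD p ^ (N - k)] ↔
      (p : ℤ) ^ N ∣ (p : ℤ) ^ k * ((a : ℤ) - b) := by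
    intro a b N k
    rw [Nat.ModEq.comm, Nat.modEq_iff_dvd, ← pow_sub_dvd_iff hp.out]
    push_cast
    rfl
  refine and_congr_right fun _ => ?_
  simp only [modEq, matrixEntry_eq_coord, Nat.cast_zero, sub_zero]
  generalize (x : AddMonoid.End G) - 1 = a
  change (∀ i j, i ≠ j → ∀ l k, (p : ℤ) ^ n j ∣ (p : ℤ) ^ upperFun n t i j *
      entry e a ⟨i, l⟩ ⟨j, k⟩) ∧
    (∀ i l, (p : ℤ) ^ n i ∣ (p : ℤ) ^ upperFun n t i i *
      (entry e a ⟨i, l⟩ ⟨i, l⟩ - entry e a ⟨Fin.last m, r⟩ ⟨Fin.last m, r⟩)) ∧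
    (∀ i l k, l ≠ k → (p : ℤ) ^ n i ∣ (p : ℤ) ^ upperFun n t i i *
      entry e a ⟨i, l⟩ ⟨i, k⟩) ↔ _
  generalize entry e a ⟨Fin.last m, r⟩ ⟨Fin.last m, r⟩ = μ
  have diag : ∀ u : Σ i, κ i, ((entry e a u u - μ : ℤ) : ZMod (p ^ n u.1)) =
      coord e u ((a - (μ : AddMonoid.End G)) (basisVec e u)) := by
    intro u
    change _ = coord e u (a (basisVec e u) - (μ : AddMonoid.End G) (basisVec e u))
    rw [map_sub, Int.cast_sub, intCast_entry, coord_intCast_self]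
  have offdiag : ∀ u v : Σ i, κ i, u ≠ v → ((entry e a u v : ℤ) : ZMod (p ^ n v.1)) =
      coord e v ((a - (μ : AddMonoid.End G)) (basisVec e u)) := by
    intro u v huv
    change _ = coord e v (a (basisVec e u) - (μ : AddMonoid.End G) (basisVec e u))
    rw [map_sub, intCast_entry, coord_intCast_of_ne e μ huv, sub_zero]
  constructor
  · rintro ⟨h1, h2, h3⟩ ⟨i, l⟩ ⟨j, k⟩
    by_cases hij : i = j
    · subst hij
      by_cases hlk : l = k
      · subst hlk
        exact (ZMod.pow_smul_eq_zero_iff (diag ⟨i, l⟩) _).2 (h2 i l)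
      · exact (ZMod.pow_smul_eq_zero_iff (offdiag ⟨i, l⟩ ⟨i, k⟩
          fun h => hlk (eq_of_heq (Sigma.mk.inj h).2)) _).2 (h3 i l k hlk)
    · exact (ZMod.pow_smul_eq_zero_iff (offdiag ⟨i, l⟩ ⟨j, k⟩
        fun h => hij (congrArg Sigma.fst h)) _).2 (h1 i j hij l k)
  · intro h
    refine ⟨fun i j hij l k => ?_, fun i l => ?_, fun i l k hlk => ?_⟩
    · exact (ZMod.pow_smul_eq_zero_iff (offdiag ⟨i, l⟩ ⟨j, k⟩
        fun h => hij (congrArg Sigma.fst h)) _).1 (h ⟨i, l⟩ ⟨j, k⟩)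
    · exact (ZMod.pow_smul_eq_zero_iff (diag ⟨i, l⟩) _).1 (h ⟨i, l⟩ ⟨i, l⟩)
    · exact (ZMod.pow_smul_eq_zero_iff (offdiag ⟨i, l⟩ ⟨i, k⟩
        fun h => hlk (eq_of_heq (Sigma.mk.inj h).2)) _).1 (h ⟨i, l⟩ ⟨i, k⟩)

theorem hypercenter_subset_congruenceSet (hn : StrictMono n) (hpos : ∀ i, 0 < n i)
    (hκ : ∀ i, Nonempty (κ i)) (hcase : CentralCase p n κ) (r : κ (Fin.last m)) (t : ℕ) :
    hypercenter G t ⊆ congruenceSet e r t := by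
  rintro _ ⟨x, hx, rfl⟩
  exact (mem_congruenceSet_iff e r t).2
    ⟨x.2, sub_entry_mem_of_mem_upperCentralSeries e hn hpos hκ hcase t hx rfl⟩

/-- The diagonal entries of an element of `𝒥` are divisible by `p`, so `1` plus the scalar given by
such an entry is a central element of `1 + 𝒥` that can be split off. -/
theorem congruenceSet_subset_mul (hn : StrictMono n) (hpos : ∀ i, 0 < n i)
    (hκ : ∀ i, Nonempty (κ i)) (r : κ (Fin.last m)) (t : ℕ) :
    congruenceSet e r t ⊆
      oneAdd (upperAnnSeries (Ring.jacobson (AddMonoid.End G)) t) * centralPart G := by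
  intro x hx
  obtain ⟨h1, h2⟩ := (mem_congruenceSet_iff e r t).1 hx
  have ha := (mem_radicalGroup_iff e hn hpos).1 h1
  obtain ⟨k, hk⟩ := dvd_entry_of_mem_radWeight e hpos ha
    (rfl : (⟨Fin.last m, r⟩ : Σ i, κ i).1 = (⟨Fin.last m, r⟩ : Σ i, κ i).1)
  rw [hk] at h2
  have hμ : ((p * k : ℤ) : AddMonoid.End G) ∈ orderBound e (radWeight n) := by
    intro u v
    by_cases huv : u = v
    · subst huv
      refine (ZMod.pow_smul_eq_zero_iff (coord_intCast_self e _ u).symm _).2 ?_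
      rw [radWeight, if_pos rfl, ← mul_assoc, ← pow_succ, Nat.sub_add_cancel (hpos _)]
      exact Dvd.intro _ rfl
    · rw [coord_intCast_of_ne e _ huv, smul_zero]
  obtain ⟨z, hz⟩ := exists_radicalGroup_eq_one_add e hn hpos hμ
  have hxz : ((x * (z : (AddMonoid.End G)ˣ)⁻¹ : (AddMonoid.End G)ˣ) : AddMonoid.End G) - 1 =
      ((x : AddMonoid.End G) - 1 - ((p * k : ℤ) : AddMonoid.End G)) *
        ((z : (AddMonoid.End G)ˣ)⁻¹ : (AddMonoid.End G)ˣ) := by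
    rw [Units.eq_mul_inv_iff_mul_eq, sub_mul, Units.val_mul, Units.inv_mul_cancel_right, one_mul,
      hz]
    abel
  refine ⟨x * (z : (AddMonoid.End G)ˣ)⁻¹, ?_, z, ⟨z.2, ?_⟩, inv_mul_cancel_right _ _⟩
  · refine (mem_upperAnnSeries_iff e hn hpos hκ t).2 ⟨?_, ?_⟩
    · exact (mem_radicalGroup_iff e hn hpos).1 (mul_mem h1 (inv_mem z.2))
    · rw [hxz]
      exact mul_mem_upperFun_right e hn _ h2
  · rw [hz]
    exact add_mem (one_mem _) (intCast_mem _ _)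

theorem mul_centralPart_subset_hypercenter (e : G ≃+ HomocyclicSum p n κ)
    (hn : StrictMono n) (hpos : ∀ i, 0 < n i) (hκ : ∀ i, Nonempty (κ i)) {t : ℕ} (ht : 1 ≤ t) :
    oneAdd (upperAnnSeries (Ring.jacobson (AddMonoid.End G)) t) * centralPart G ⊆
      hypercenter G t := by
  rintro _ ⟨y, hy, z, ⟨hz, hzc⟩, rfl⟩
  obtain ⟨h1, h2⟩ := (mem_upperAnnSeries_iff e hn hpos hκ t).1 hy
  refine ⟨⟨y, (mem_radicalGroup_iff e hn hpos).2 h1⟩ * ⟨z, hz⟩, mul_mem ?_ ?_, rfl⟩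
  · exact mem_upperCentralSeries_of_mem_upperFun e hn hpos t _ h2
  · refine Subgroup.upperCentralSeries_mono _ ht ?_
    rw [Subgroup.upperCentralSeries_one, Subgroup.mem_center_iff]
    exact fun g => Subtype.ext (Units.ext (Subring.mem_center_iff.1 hzc _))

end Coordinates

theorem mainTheorem1 {m : ℕ} (p : ℕ) (hp : p.Prime)
    (n : Fin (m + 1) → ℕ) (hpos : ∀ i, 0 < n i) (hn : StrictMono n)
    (κ : Fin (m + 1) → Type u) (hκ : ∀ i, Nonempty (κ i))
    (G : Type v) [AddCommGroup G] (e : G ≃+ HomocyclicSum p n κ)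
    (hcase : 3 ≤ p ∨ 2 ≤ minGap n ∨ (1 < #(κ (Fin.last m)) ∧ 2 ≤ m + 1))
    (t : ℕ) (ht : 1 ≤ t) :
    hypercenter G t =
        oneAdd (upperAnnSeries (Ring.jacobson (AddMonoid.End G)) t) * centralPart G ∧
      ∀ r : κ (Fin.last m), hypercenter G t = congruenceSet e r t := by
  have : Fact p.Prime := ⟨hp⟩
  have hcase' : CentralCase p n κ := by
    refine hcase.imp id fun h => h.imp (fun h i j hij => ?_) fun h =>
      Cardinal.one_lt_iff_nontrivial.1 h.1
    have hi : (i : ℕ) < m := by omega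
    have h1 := h.trans (iInf_le _ (⟨i, hi⟩ : Fin m))
    have h2 : (⟨i, hi⟩ : Fin m).succ = j := by ext; simp [hij]
    have h3 : (⟨i, hi⟩ : Fin m).castSucc = i := rfl
    rw [h2, h3] at h1
    have h4 : 2 ≤ n j - n i := by exact_mod_cast h1
    omega
  have h1 := fun r => hypercenter_subset_congruenceSet e hn hpos hκ hcase' r t
  have h2 := fun r => congruenceSet_subset_mul e hn hpos hκ r t
  have h3 := mul_centralPart_subset_hypercenter e hn hpos hκ ht
  obtain ⟨r₀⟩ := hκ (Fin.last m)
  exact ⟨((h1 r₀).trans (h2 r₀)).antisymm h3, fun r => (h1 r).antisymm ((h2 r).trans h3)⟩
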